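/- Let $t\in\{0,\dots,5\}$, $\eta_{ab}=\eta^{ab}=\mathrm{diag}(-1,\dots,-1,1,\dots,1)$ with $t$ entries $-1$ and $5-t$ entries $+1$, and let $k_a=\mathrm{i}$ for $a\le t$ and $k_a=1$ for $a>t$. With the Pauli matrices $\sigma_1,\sigma_2,\sigma_3$ and $\sigma_0=\mathbb 1$ consider the $4\times4$ matrices $$\gamma_1=k_1\sigma_1\otimes\sigma_0,\ \gamma_2=k_2\sigma_2\otimes\sigma_0,\ \gamma_3=k_3\sigma_3\otimes\sigma_1,\ \gamma_4=k_4\sigma_3\otimes\sigma_2,\ \gamma_5=k_5\sigma_3\otimes\sigma_3,\quad C=\sigma_1\otimes\sigma_2,$$ or any spinor representation equivalent to it, i.e. $(S^{-1}\gamma_aS,\ S^{\top}CS)$ with an invertible complex $4\times4$ matrix $S$; denote the latter again by $(\gamma_a,C)$, and put $\gamma^a=\eta^{ab}\gamma_b$, $\gamma_{ab}=\tfrac12(\gamma_a\gamma_b-\gamma_b\gamma_a)$. Let $\Omega$ be the algebra of polynomials with complex coefficients in anticommuting variables $c^1,\dots,c^5$ (translation ghosts) and commuting variables $\xi_i^{\alpha}$,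 $i=1,2$, $\alpha=1,\dots,4$ (supersymmetry ghosts, arranged in row vectors $\xi_1,\xi_2$), and let $$\mathfrak b=-\tfrac12\sum_{i,j=1}^{2}\sum_{\alpha,\beta=1}^4\sum_{a=1}^5 M^{ij}(\gamma^aC^{-1})_{\alpha\beta}\,\xi_i^\alpha\xi_j^\beta\,\frac{\partial}{\partial c^a},\qquad M=\sigma_2,$$ where $\partial/\partial c^a$ is the left derivative. For $\omega_1,\omega_2\in\Omega$ write $\omega_1\sim\omega_2$ if $\omega_1-\omega_2=\mathfrak b\,\omega_3$ for some $\omega_3\in\Omega$. Set $$\theta_{ij}=\sum_{a,b}c^ac^b\,\xi_i\gamma_{ab}C^{-1}\xi_j^{\top},\qquad \theta_{a\,ij}=\sum_b c^b\,\xi_i\gamma_{ba}C^{-1}\xi_j^{\top}.$$ Then for every $\omega\in\Omega$: $\mathfrak b\,\omega=0$ if and only if there are complex polynomials $P,P^{ij},P^{a\,ij}$ ($1\le i\le j\le2$, $a=1,\dots,5$) in the components of $\xi_1$ and $\xi_2$ such that $$\omega\sim P(\xi_1,\xi_2)+\sum_{1\le i\le j\le 2}\theta_{ij}P^{ij}(\xi_1,\xi_2)+\sum_{a=1}^5\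 \sum_{1\le i\le j\le 2}\theta_{a\,ij}P^{a\,ij}(\xi_1,\xi_2).$$ In particular, the cohomology vanishes at every $c$-degree $p>2$: if $\omega$ is homogeneous of degree $p>2$ in the $c^a$, then $\mathfrak b\,\omega=0$ if and only if $\omega\sim0$. -/

import Mathlib

open scoped Matrix Kronecker

noncomputable section

namespace Susy5

/-- The four values of a spinor index; `ξ¹, ξ², ξ³, ξ⁴` correspond to `(0,0), (0,1), (1,0), (1,1)`,
so that `Matrix.kronecker` of two `2 × 2` matrices is directly a matrix on spinors. -/
abbrev SpinorIdx : Type := Fin 2 × Fin 2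

abbrev SpinorMatrix : Type := Matrix SpinorIdx SpinorIdx ℂ

/-! ### Gamma matrices and charge conjugation in five dimensions, signature `(t, 5 - t)` -/

def pauli0 : Matrix (Fin 2) (Fin 2) ℂ := 1
def pauli1 : Matrix (Fin 2) (Fin 2) ℂ := !![0, 1; 1, 0]
def pauli2 : Matrix (Fin 2) (Fin 2) ℂ := !![0, -Complex.I; Complex.I, 0]
def pauli3 : Matrix (Fin 2) (Fin 2) ℂ := !![1, 0; 0, -1]

/-- Vector indices `1, …, 5` are represented by `0, …, 4 : Fin 5`. The prefactor `k_a` is `i` for the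
first `t` directions and `1` for the others. -/
def kFactor (t : ℕ) (a : Fin 5) : ℂ := if (a : ℕ) < t then Complex.I else 1

/-- Diagonal entries of the metric of signature `(t, 5 - t)`; the metric is its own inverse. -/
def etaDiag (t : ℕ) (a : Fin 5) : ℂ := if (a : ℕ) < t then -1 else 1

/-- The particular gamma matrices `γ_a` (lower vector index). -/
def stdGamma (t : ℕ) (a : Fin 5) : SpinorMatrix :=
  kFactor t a •
    (![pauli1 ⊗ₖ pauli0, pauli2 ⊗ₖ pauli0, pauli3 ⊗ₖ pauli1, pauli3 ⊗ₖ pauli2,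
       pauli3 ⊗ₖ pauli3] : Fin 5 → SpinorMatrix) a

/-- The particular charge conjugation matrix. -/
def stdC : SpinorMatrix := pauli1 ⊗ₖ pauli2

/-- `(γ_a, C)` is a spinor representation of signature `(t, 5 - t)` equivalent to the particular
one: it arises from it by an invertible change of basis `S` of spinor space, under which `γ_a`
transforms as an endomorphism and `C⁻¹` as a bilinear form on (row) spinors. -/
def IsSpinorRep (t : ℕ) (γ : Fin 5 → SpinorMatrix) (C : SpinorMatrix) : Prop :=
  ∃ S : SpinorMatrix, IsUnit S ∧ (∀ a, γ a = S⁻¹ * stdGamma t a * S) ∧ C = Sᵀ * stdC * S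

/-- The gamma matrices `γ^a` with upper vector index. -/
def gammaUp (t : ℕ) (γ : Fin 5 → SpinorMatrix) (a : Fin 5) : SpinorMatrix := etaDiag t a • γ a

/-- `γ_{ab} = ½ (γ_a γ_b - γ_b γ_a)`. -/
def gamma2 (γ : Fin 5 → SpinorMatrix) (a b : Fin 5) : SpinorMatrix :=
  (1 / 2 : ℂ) • (γ a * γ b - γ b * γ a)

/-! ### Ghost polynomials for `N = 2` -/

/-- Polynomials over `ℂ` in the commuting supersymmetry ghosts `ξ_i^α`, `i ∈ {1, 2}`. -/
abbrev XiPoly : Type := MvPolynomial (Fin 2 × SpinorIdx) ℂ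

/-- Ghost polynomials: the translation ghosts `c^1, …, c^5` anticommute, so these are the elements
of the exterior algebra over `XiPoly` of the free module on five generators. -/
abbrev GhostPoly : Type := ExteriorAlgebra XiPoly (Fin 5 → XiPoly)

/-- The component `ξ_i^α`. -/
def xi (i : Fin 2) (α : SpinorIdx) : XiPoly := MvPolynomial.X (i, α)

/-- The translation ghost `c^a`. -/
def c (a : Fin 5) : GhostPoly := ExteriorAlgebra.ι XiPoly (Pi.single a 1)

/-- The left derivative `∂/∂c^a`, an antiderivation with `∂c^b/∂c^a = δ^b_a`. -/
def dc (a : Fin 5) : GhostPoly →ₗ[XiPoly] GhostPoly :=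
  CliffordAlgebra.contractLeft (Q := (0 : QuadraticForm XiPoly (Fin 5 → XiPoly)))
    (LinearMap.proj a)

/-- The bilinear expression `ξ_i A ξ_j^⊤ = ∑_{α,β} ξ_i^α A_{αβ} ξ_j^β`. -/
def bil (A : SpinorMatrix) (i j : Fin 2) : XiPoly :=
  ∑ α, ∑ β, MvPolynomial.C (A α β) * xi i α * xi j β

/-- The coboundary operator
`fb = -½ M^{ij} (γ^a C⁻¹)_{αβ} ξ_i^α ξ_j^β ∂/∂c^a` with `M = σ₂`. -/
def fb (t : ℕ) (γ : Fin 5 → SpinorMatrix) (C : SpinorMatrix) : GhostPoly →ₗ[XiPoly] GhostPoly :=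
  ∑ a, (MvPolynomial.C (-1 / 2 : ℂ) *
    ∑ i, ∑ j, MvPolynomial.C (pauli2 i j) * bil (gammaUp t γ a * C⁻¹) i j) • dc a

/-- `ω₁ ∼ ω₂`: the difference is a coboundary. -/
def Equivalent (t : ℕ) (γ : Fin 5 → SpinorMatrix) (C : SpinorMatrix) (ω₁ ω₂ : GhostPoly) : Prop :=
  ∃ η : GhostPoly, ω₁ - ω₂ = fb t γ C η

/-- `θ_{ij} = c^a c^b ξ_i γ_{ab} C⁻¹ ξ_j^⊤`. -/
def theta (γ : Fin 5 → SpinorMatrix) (C : SpinorMatrix) (i j : Fin 2) : GhostPoly :=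
  ∑ a, ∑ b, bil (gamma2 γ a b * C⁻¹) i j • (c a * c b)

/-- `θ_{a ij} = c^b ξ_i γ_{ba} C⁻¹ ξ_j^⊤`. -/
def thetaVec (γ : Fin 5 → SpinorMatrix) (C : SpinorMatrix) (a : Fin 5) (i j : Fin 2) : GhostPoly :=
  ∑ b, bil (gamma2 γ b a * C⁻¹) i j • c b

/-- The general representative
`P + ∑_{i ≤ j} θ_{ij} P^{ij} + ∑_a ∑_{i ≤ j} θ_{a ij} P^{a ij}`. -/
def representative (γ : Fin 5 → SpinorMatrix) (C : SpinorMatrix)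
    (P P11 P12 P22 : XiPoly) (Q11 Q12 Q22 : Fin 5 → XiPoly) : GhostPoly :=
  algebraMap XiPoly GhostPoly P
    + (P11 • theta γ C 0 0 + P12 • theta γ C 0 1 + P22 • theta γ C 1 1)
    + ∑ a, (Q11 a • thetaVec γ C a 0 0 + Q12 a • thetaVec γ C a 0 1 + Q22 a • thetaVec γ C a 1 1)

end Susy5

end

open scoped Matrix Kronecker

noncomputable section

set_option linter.unusedSimpArgs false

/-! The operator is the Koszul differential of five quadrics, the coefficients of the derivatives
with respect to the ghosts `c^a`. As `M` and all `γ^a C⁻¹` are antisymmetric, these quadrics are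
combinations of 2×2 minors of the 2×4 matrix with rows `ξ_1, ξ_2`. An equivalent spinor
representation is a linear substitution `ψ` of the `ξ`, and the signature is absorbed by rescaling
the `c^a`. Hence one null frame `e_0, …, e_4` serves all cases; in it the quadrics are `q_k = ψ
(quad k)`.

The last two, `q_3` and `q_4`, are the determinants of the two 2×2 blocks `A = 0, 1` and form a
regular sequence. By `cone_cone_exact` it is enough to understand the Koszul complex of `q_0, q_1,
q_2` modulo `(q_3, q_4)`. Writing the blocks of determinant zero as rank one matrices, `ξ_i^{(A,α)}
= s_{A,i} a_A^α`, embeds the quotient ring as the weight zero part of a polynomial ring in eight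
variables (`exists_of_segre_eq_zero`, `exists_segre_eq`). With `a, b` the components of `a_0` and
`a', b'` those of `a_1`, the three quadrics become `D·aa'`, `D·bb'`, `D·(ab' + ba')`, where `D =
s_{0,0} s_{1,1} - s_{0,1} s_{1,0}`.

Since `D ≠ 0`, cycles are governed by `aa', bb', ab' + ba'` alone, whereas boundaries carry the
factor `D`. The syzygies of these three are the three Koszul ones and two further ones, with
coefficients `(-b², -a², ab)` and its primed version (`exists_syzygy`). In total weight zero their
multipliers have negative weight, so they are combinations of products of two `s`. A multiplier
built from `s_{0,i} s_{1,j}` splits into a part symmetric in `i, j` and a multiple of `D`, and the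
latter is a boundary (`exists_of_hasWt_neg_neg`). What survives is five families times three
symmetric index pairs, which are the `θ_{a ij}`. In degree two there is a single family, giving the
`θ_{ij}`; in degree three nothing survives (`kosz3_exact`).

The `θ`'s are genuine cocycles by `sum_quad_mul_frameBil`, and `exists_hasPart` matches them with
the surviving cycles. They have degree at most two, so projection to degree `p > 2` gives the
vanishing statement. -/

namespace Susy5

/-! ### Mapping cones and reduction modulo a regular sequence of length two. -/

section Cone

variable {R M : Type*} [CommRing R] [AddCommGroup M] [Module R M]

/-- The differential of the mapping cone of multiplication by `q` on `(M, d)`. The pair `(α, β)`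
stands for `α + e β` with an odd variable `e` whose differential is `q`. -/
def cone (d : M →ₗ[R] M) (q : R) : M × M →ₗ[R] M × M :=
  (d.coprod (q • LinearMap.id)).prod (-(d ∘ₗ LinearMap.snd R M M))

@[simp]
lemma cone_apply (d : M →ₗ[R] M) (q : R) (m : M × M) :
    cone d q m = (d m.1 + q • m.2, -d m.2) := rfl

/-- The component `α` free of both odd variables is a cycle modulo `(p, q)`. After `h` corrects it
by a boundary and a cocycle from `Θ`, the next two components satisfy `p • β' + q • γ' = 0`.
Regularity forces `β' = q • m` and `γ' = -(p • m)`, which the top component `m` of the primitive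
absorbs; the last component is then determined, because `q` is a nonzerodivisor. -/
lemma cone_cone_exact (d : M →ₗ[R] M) (hd : ∀ m, d (d m) = 0) (p q : R) (reg_q : ∀ m : M, q • m = 0 → m = 0)
    (reg_p : ∀ m n : M, p • m = q • n → ∃ m', m = q • m') (Θ : Set ((M × M) × (M × M)))
    (hΘ : ∀ θ ∈ Θ, cone (cone d p) q θ = 0)
    (h : ∀ α β γ : M, d α = p • β + q • γ →
      ∃ θ ∈ Θ, ∃ η ζ ξ, α = d η + p • ζ + q • ξ + θ.1.1)
    (ω : (M × M) × (M × M)) (hω : cone (cone d p) q ω = 0) :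
    ∃ θ ∈ Θ, ∃ η, ω = cone (cone d p) q η + θ := by
  obtain ⟨⟨α, β⟩, γ, δ⟩ := ω
  simp only [cone_apply, Prod.ext_iff, Prod.fst_add, Prod.snd_add, Prod.smul_fst, Prod.smul_snd,
    Prod.fst_neg, Prod.snd_neg, Prod.fst_zero, Prod.snd_zero] at hω
  obtain ⟨⟨h1, h2⟩, h3, h4⟩ := hω
  obtain ⟨θ, hθ, η, ζ, ξ, rfl⟩ := h α (-β) (-γ) (by
    rw [smul_neg, smul_neg, ← sub_eq_zero, ← h1]; abel)
  have hcoc := hΘ θ hθ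
  obtain ⟨⟨θ₁, θ₂⟩, θ₃, θ₄⟩ := θ
  simp only [cone_apply, Prod.ext_iff, Prod.fst_add, Prod.snd_add, Prod.smul_fst, Prod.smul_snd,
    Prod.fst_neg, Prod.snd_neg, Prod.fst_zero, Prod.snd_zero] at hcoc
  obtain ⟨⟨t1, t2⟩, t3, t4⟩ := hcoc
  simp only [map_add, map_smul, hd] at h1 h2 h3 t1 t2 t3
  obtain ⟨m, hm⟩ := reg_p (β - θ₂ + d ζ) (-(γ - θ₃ + d ξ)) (by
    linear_combination (norm := module) h1 - t1)
  have hγ : γ - θ₃ + d ξ = -(p • m) := by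
    rw [eq_neg_iff_add_eq_zero]
    refine reg_q _ ?_
    have : p • (β - θ₂ + d ζ) = p • q • m := by rw [hm]
    rw [smul_comm p q m] at this
    linear_combination (norm := module) h1 - t1 - this
  have hδ : δ - θ₄ = d m := by
    rw [← sub_eq_zero]
    refine reg_q _ ?_
    have : d (β - θ₂ + d ζ) = d (q • m) := by rw [hm]
    simp only [map_add, map_sub, map_smul, hd] at this
    linear_combination (norm := module) h2 - t2 + this
  refine ⟨_, hθ, ((η, ζ), ξ, m), ?_⟩
  simp only [cone_apply, Prod.ext_iff, Prod.fst_add, Prod.snd_add, Prod.smul_fst, Prod.smul_snd,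
    Prod.fst_neg, Prod.snd_neg]
  refine ⟨⟨trivial, ?_⟩, ?_, ?_⟩
  · linear_combination (norm := module) hm
  · linear_combination (norm := module) hγ
  · linear_combination (norm := module) hδ

end Cone

/-! ### Exterior algebras as iterated mapping cones. -/

section Exterior

variable {R V : Type*} [CommRing R] [AddCommGroup V] [Module R V]

/-- Contraction of exterior forms with a functional. -/
abbrev contract (f : Module.Dual R V) : ExteriorAlgebra R V →ₗ[R] ExteriorAlgebra R V :=
  CliffordAlgebra.contractLeft (Q := (0 : QuadraticForm R V)) f

lemma contract_ι_mul (f : Module.Dual R V) (v : V) (x : ExteriorAlgebra R V) :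
    contract f (ExteriorAlgebra.ι R v * x) = f v • x - ExteriorAlgebra.ι R v * contract f x :=
  CliffordAlgebra.contractLeft_ι_mul (Q := 0) f v x

/-- `(M, d)` embeds through `Φ` as a subcomplex of the exterior algebra with differential
`contract Q`, namely as the subalgebra generated by the `e l` with `l ∉ S`. -/
structure IsKoszulModel {ι M : Type*} [AddCommGroup M] [Module R M] (Q : Module.Dual R V)
    (e : ι → V) (e' : ι → Module.Dual R V) (S : Set ι) (d : M →ₗ[R] M)
    (Φ : M →ₗ[R] ExteriorAlgebra R V) : Prop where
  inj : ∀ m, Φ m = 0 → m = 0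
  comm : ∀ m, contract Q (Φ m) = Φ (d m)
  kill : ∀ l ∈ S, ∀ m, contract (e' l) (Φ m) = 0
  mul_mem : ∀ l ∉ S, ∀ m, ∃ m', ExteriorAlgebra.ι R (e l) * Φ m = Φ m'
  one_mem : ∃ m, Φ m = 1

/-- The map `(α, β) ↦ α + v β`. -/
def adjoinι {M : Type*} [AddCommGroup M] [Module R M] (Φ : M →ₗ[R] ExteriorAlgebra R V) (v : V) :
    M × M →ₗ[R] ExteriorAlgebra R V :=
  Φ.coprod (LinearMap.mulLeft R (ExteriorAlgebra.ι R v) ∘ₗ Φ)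

@[simp]
lemma adjoinι_apply {M : Type*} [AddCommGroup M] [Module R M]
    (Φ : M →ₗ[R] ExteriorAlgebra R V) (v : V) (m : M × M) :
    adjoinι Φ v m = Φ m.1 + ExteriorAlgebra.ι R v * Φ m.2 := rfl

lemma isKoszulModel_base {ι : Type*} (Q : Module.Dual R V) (e : ι → V)
    (e' : ι → Module.Dual R V) :
    IsKoszulModel Q e e' Set.univ 0 (Algebra.linearMap R (ExteriorAlgebra R V)) where
  inj m hm := (ExteriorAlgebra.algebraMap_leftInverse V).injective (by simpa using hm)
  comm m := by simp
  kill l _ m := by simp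
  mul_mem l hl := absurd (Set.mem_univ l) hl
  one_mem := ⟨1, by simp⟩

/-- Contraction with the dual vector `e' k` annihilates the image of `Φ` and so isolates `β` in `α +
e_k β`; this gives injectivity. The signs in `cone` and in `mul_mem` come from moving an odd factor
past `e_k`. -/
lemma IsKoszulModel.adjoin {ι M : Type*} [AddCommGroup M] [Module R M] {Q : Module.Dual R V}
    {e : ι → V} {e' : ι → Module.Dual R V} {S : Set ι} {d : M →ₗ[R] M}
    {Φ : M →ₗ[R] ExteriorAlgebra R V} (h : IsKoszulModel Q e e' S d Φ)
    (dual : ∀ k, e' k (e k) = 1) (dual' : ∀ k l, k ≠ l → e' k (e l) = 0) {k : ι} (hk : k ∈ S)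
    {q : R} (hq : Q (e k) = q) :
    IsKoszulModel Q e e' (S \ {k}) (cone d q) (adjoinι Φ (e k)) where
  inj := by
    rintro ⟨α, β⟩ hm
    have hβ : β = 0 := by
      apply h.inj
      have := congrArg (contract (e' k)) hm
      simpa [contract_ι_mul, h.kill k hk, dual] using this
    subst hβ
    simpa using h.inj α (by simpa using hm)
  comm := by
    rintro ⟨α, β⟩
    simp only [adjoinι_apply, map_add, contract_ι_mul, h.comm, cone_apply, hq, map_smul, map_neg,
      mul_neg]
    abel
  kill := by
    rintro l ⟨hl, hlk⟩ ⟨α, β⟩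
    simp [contract_ι_mul, h.kill l hl, dual' l k hlk]
  mul_mem := by
    rintro l hl ⟨α, β⟩
    by_cases hlk : l = k
    · subst hlk
      refine ⟨(0, α), ?_⟩
      simp [mul_add, ← mul_assoc]
    · obtain ⟨α', hα⟩ := h.mul_mem l (fun h' => hl ⟨h', hlk⟩) α
      obtain ⟨β', hβ⟩ := h.mul_mem l (fun h' => hl ⟨h', hlk⟩) β
      refine ⟨(α', -β'), ?_⟩
      have := ExteriorAlgebra.ι_add_mul_swap (R := R) (e l) (e k)
      simp only [adjoinι_apply, mul_add, map_neg, hα, ← hβ, ← mul_assoc, mul_neg]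
      rw [eq_neg_of_add_eq_zero_left this, neg_mul]
  one_mem := by
    obtain ⟨m, hm⟩ := h.one_mem
    exact ⟨(m, 0), by simp [hm]⟩

lemma IsKoszulModel.surjective {ι M : Type*} [AddCommGroup M] [Module R M] {Q : Module.Dual R V}
    {e : ι → V} {e' : ι → Module.Dual R V} {d : M →ₗ[R] M}
    {Φ : M →ₗ[R] ExteriorAlgebra R V} (h : IsKoszulModel Q e e' ∅ d Φ)
    (span : Submodule.span R (Set.range e) = ⊤) (x : ExteriorAlgebra R V) : ∃ m, Φ m = x := by
  induction x using CliffordAlgebra.left_induction with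
  | algebraMap r =>
    obtain ⟨m, hm⟩ := h.one_mem
    exact ⟨r • m, by rw [map_smul, hm, Algebra.algebraMap_eq_smul_one]⟩
  | add x y hx hy =>
    obtain ⟨m, rfl⟩ := hx
    obtain ⟨n, rfl⟩ := hy
    exact ⟨m + n, map_add _ _ _⟩
  | ι_mul x v hx =>
    obtain ⟨m, rfl⟩ := hx
    have hv : v ∈ Submodule.span R (Set.range e) := span ▸ Submodule.mem_top
    change ∃ m', Φ m' = ExteriorAlgebra.ι R v * Φ m
    induction hv using Submodule.span_induction with
    | mem v hv =>
      obtain ⟨l, rfl⟩ := hv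
      obtain ⟨m', hm'⟩ := h.mul_mem l (Set.notMem_empty l) m
      exact ⟨m', hm'.symm⟩
    | zero => exact ⟨0, by simp⟩
    | add v w _ _ hv hw =>
      obtain ⟨a, ha⟩ := hv
      obtain ⟨b, hb⟩ := hw
      exact ⟨a + b, by rw [map_add, map_add, ha, hb, add_mul]⟩
    | smul r v _ hv =>
      obtain ⟨a, ha⟩ := hv
      exact ⟨r • a, by rw [map_smul, map_smul, ha, smul_mul_assoc]⟩

/-! ### Contractions lower the degree -/

lemma contract_mem (f : Module.Dual R V) (p : ℕ) {x : ExteriorAlgebra R V}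
    (hx : x ∈ ⋀[R]^(p + 1) V) : contract f x ∈ ⋀[R]^p V := by
  induction p generalizing x with
  | zero =>
    obtain ⟨v, rfl⟩ : x ∈ LinearMap.range (ExteriorAlgebra.ι R (M := V)) := by
      simpa [ExteriorAlgebra.exteriorPower] using hx
    rw [ExteriorAlgebra.exteriorPower, pow_zero, Submodule.mem_one]
    exact ⟨f v, (CliffordAlgebra.contractLeft_ι (Q := 0) f v).symm⟩
  | succ p ih =>
    rw [ExteriorAlgebra.exteriorPower, pow_succ'] at hx
    induction hx using Submodule.mul_induction_on' with
    | mem_mul_mem v hv y hy =>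
      obtain ⟨v, rfl⟩ := hv
      rw [contract_ι_mul]
      refine Submodule.sub_mem _ (Submodule.smul_mem _ _ hy) ?_
      rw [ExteriorAlgebra.exteriorPower, pow_succ']
      exact Submodule.mul_mem_mul ⟨v, rfl⟩ (ih hy)
    | add x _ y _ hx hy => rw [map_add]; exact Submodule.add_mem _ hx hy

/-- Contraction lowers the degree by exactly one, so on homogeneous elements the projection either
keeps the contraction or kills it. -/
lemma exists_proj_contract (f : Module.Dual R V) (p : ℕ) (y : ExteriorAlgebra R V) :
    ∃ y', GradedRing.proj (fun i : ℕ ↦ ⋀[R]^i V) p (contract f y) = contract f y' := by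
  induction y using DirectSum.Decomposition.inductionOn (fun i : ℕ ↦ ⋀[R]^i V) with
  | zero => exact ⟨0, by simp⟩
  | @homogeneous i y =>
    obtain ⟨y, hy⟩ := y
    cases i with
    | zero =>
      rw [ExteriorAlgebra.exteriorPower, pow_zero, Submodule.mem_one] at hy
      obtain ⟨r, rfl⟩ := hy
      exact ⟨0, by simp⟩
    | succ i =>
      have := contract_mem f i hy
      rw [GradedRing.proj_apply]
      by_cases hip : i = p
      · subst hip
        exact ⟨y, by rw [DirectSum.decompose_of_mem_same (fun i : ℕ ↦ ⋀[R]^i V) this]⟩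
      · exact ⟨0, by rw [DirectSum.decompose_of_mem_ne (fun i : ℕ ↦ ⋀[R]^i V) this hip, map_zero]⟩
  | add y z hy hz =>
    obtain ⟨a, ha⟩ := hy
    obtain ⟨b, hb⟩ := hz
    exact ⟨a + b, by rw [map_add, map_add, ha, hb, map_add]⟩

lemma exists_eq_contract_of_mem (f : Module.Dual R V) (p : ℕ) {x y z : ExteriorAlgebra R V}
    (hx : x ∈ ⋀[R]^p V) (hz : GradedRing.proj (fun i : ℕ ↦ ⋀[R]^i V) p z = 0)
    (h : x = contract f y + z) : ∃ y', x = contract f y' := by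
  obtain ⟨y', hy'⟩ := exists_proj_contract f p y
  refine ⟨y', ?_⟩
  rw [← hy', ← add_zero (GradedRing.proj _ p (contract f y)), ← hz, ← map_add, ← h,
    GradedRing.proj_apply, DirectSum.decompose_of_mem_same (fun i : ℕ ↦ ⋀[R]^i V) hx]

end Exterior

open MvPolynomial

/-! ### A parametrization of pairs of rank one matrices -/

/-- Polynomials in variables `a_A^α` (first index `0`) and `s_{A,i}` (first index `1`). -/
abbrev SegrePoly : Type := MvPolynomial (Fin 2 × Fin 2 × Fin 2) ℂ

/-- The parametrization `ξ_i^{(A, α)} = s_{A,i} a_A^α`. -/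
def segre : XiPoly →ₐ[ℂ] SegrePoly :=
  aeval fun v => X (0, v.2.1, v.2.2) * X (1, v.2.1, v.1)

@[simp]
lemma segre_xi (i : Fin 2) (v : SpinorIdx) : segre (xi i v) = X (0, v.1, v.2) * X (1, v.1, i) := by
  simp [segre, xi]

/-- The `2 × 2` minors of the matrix with rows `ξ_1` and `ξ_2`. -/
def minor (v w : SpinorIdx) : XiPoly := xi 0 v * xi 1 w - xi 0 w * xi 1 v

/-- A monomial with coefficient one. -/
def mono {ι : Type*} [Fintype ι] (m : ι → ℕ) : MvPolynomial ι ℂ := ∏ i, X i ^ m i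

lemma mono_eq_monomial {ι : Type*} [Fintype ι] (m : ι → ℕ) :
    mono m = monomial (Finsupp.equivFunOnFinite.symm m) 1 := by
  rw [monomial_eq, Finsupp.prod_fintype _ _ (fun _ => pow_zero _)]
  simp [mono]

lemma monomial_eq_smul_mono {ι : Type*} [Fintype ι] (m : ι →₀ ℕ) (r : ℂ) :
    monomial m r = r • mono m := by
  rw [mono_eq_monomial, smul_monomial, smul_eq_mul, mul_one, Finsupp.equivFunOnFinite_symm_coe]

/-- The exponents of the image of a monomial under `segre`. -/
def segreExp (m : Fin 2 × SpinorIdx → ℕ) (v : Fin 2 × Fin 2 × Fin 2) : ℕ :=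
  if v.1 = 0 then m (0, v.2.1, v.2.2) + m (1, v.2.1, v.2.2)
  else m (v.2.2, v.2.1, 0) + m (v.2.2, v.2.1, 1)

/-- The exponents of a preimage under `segre` of a monomial of weight zero. -/
def sectionExp (n : Fin 2 × Fin 2 × Fin 2 → ℕ) (v : Fin 2 × SpinorIdx) : ℕ :=
  if v.1 = v.2.2 then min (n (0, v.2.1, v.1)) (n (1, v.2.1, v.1))
  else n (1, v.2.1, v.1) - n (0, v.2.1, v.1)

lemma segre_mono (m : Fin 2 × SpinorIdx → ℕ) : segre (mono m) = mono (segreExp m) := by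
  simp only [mono, map_mul, map_pow, segre, aeval_X, Fintype.prod_prod_type, Fin.prod_univ_two,
    segreExp, one_ne_zero, if_true, if_false]
  ring

/-- A linear map which inverts `segre` on its range. -/
def segreSection : SegrePoly →ₗ[ℂ] XiPoly :=
  (basisMonomials (Fin 2 × Fin 2 × Fin 2) ℂ).constr ℂ fun n => mono (sectionExp n)

lemma segreSection_mono (n : Fin 2 × Fin 2 × Fin 2 → ℕ) :
    segreSection (mono n) = mono (sectionExp n) := by
  have := (basisMonomials (Fin 2 × Fin 2 × Fin 2) ℂ).constr_basis ℂ
    (fun n => mono (sectionExp n)) (Finsupp.equivFunOnFinite.symm n)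
  rw [coe_basisMonomials] at this
  rw [mono_eq_monomial]
  exact this

/-- The ideal of the relations in one of the two blocks each. -/
def minorIdeal : Ideal XiPoly := Ideal.span {minor (0, 0) (0, 1), minor (1, 0) (1, 1)}

/-- Straightening: each factor `y * z` is traded for `x * w` until `y` or `z` is exhausted. The
resulting exponents depend only on row and column sums, which is all that `segre` sees of a
monomial. -/
lemma block_pow_eq {A : Type*} [CommRing A] {x y z w : A} (h : x * w = y * z) (i j k l : ℕ) :
    x ^ i * y ^ j * (z ^ k * w ^ l) =
      x ^ (min (i + k) (i + j)) * y ^ (i + j - (i + k)) *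
        (z ^ (k + l - (j + l)) * w ^ (min (j + l) (k + l))) := by
  rcases le_total j k with hjk | hjk
  · obtain ⟨n, rfl⟩ := Nat.exists_eq_add_of_le hjk
    rw [min_eq_right (by omega), min_eq_left (by omega), show i + j - (i + (j + n)) = 0 by omega,
      show j + n + l - (j + l) = n by omega]
    have := congrArg (· ^ j) h
    simp only [mul_pow] at this
    linear_combination -(x ^ i * w ^ l * z ^ n) * this
  · obtain ⟨n, rfl⟩ := Nat.exists_eq_add_of_le hjk
    rw [min_eq_left (by omega), min_eq_right (by omega), show i + (k + n) - (i + k) = n by omega,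
      show k + l - (k + n + l) = 0 by omega]
    have := congrArg (· ^ k) h
    simp only [mul_pow] at this
    linear_combination -(x ^ i * w ^ l * y ^ n) * this

lemma mono_sub_mem (m : Fin 2 × SpinorIdx → ℕ) :
    mono m - mono (sectionExp (segreExp m)) ∈ minorIdeal := by
  rw [← Ideal.Quotient.eq]
  have h0 : Ideal.Quotient.mk minorIdeal (minor (0, 0) (0, 1)) = 0 :=
    Ideal.Quotient.eq_zero_iff_mem.2 (Ideal.subset_span (by simp))
  have h1 : Ideal.Quotient.mk minorIdeal (minor (1, 0) (1, 1)) = 0 :=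
    Ideal.Quotient.eq_zero_iff_mem.2 (Ideal.subset_span (by simp))
  simp only [minor, map_sub, map_mul, sub_eq_zero, xi] at h0 h1
  have e0 := block_pow_eq h0 (m (0, 0, 0)) (m (0, 0, 1)) (m (1, 0, 0)) (m (1, 0, 1))
  have e1 := block_pow_eq h1 (m (0, 1, 0)) (m (0, 1, 1)) (m (1, 1, 0)) (m (1, 1, 1))
  simp only [mono, map_mul, map_pow, Fintype.prod_prod_type, Fin.prod_univ_two, sectionExp,
    segreExp, one_ne_zero, zero_ne_one, if_true, if_false]
  linear_combination congrArg₂ (· * ·) e0 e1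

lemma sub_segreSection_mem (r : XiPoly) : r - segreSection (segre r) ∈ minorIdeal := by
  induction r using MvPolynomial.induction_on' with
  | monomial m c =>
    rw [monomial_eq_smul_mono, map_smul, map_smul, segre_mono, segreSection_mono, ← smul_sub]
    exact Submodule.smul_of_tower_mem _ _ (mono_sub_mem m)
  | add p q hp hq =>
    rw [map_add, map_add, add_sub_add_comm]
    exact add_mem hp hq

/-- Modulo the two minors, `segreSection` is a left inverse of `segre`, so nothing else is in the
kernel. -/
lemma exists_of_segre_eq_zero {r : XiPoly} (hr : segre r = 0) :
    ∃ β γ, r = minor (0, 0) (0, 1) * β + minor (1, 0) (1, 1) * γ := by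
  have := sub_segreSection_mem r
  rw [hr, map_zero, sub_zero, minorIdeal, Ideal.mem_span_pair] at this
  obtain ⟨β, γ, h⟩ := this
  exact ⟨β, γ, by rw [← h]; ring⟩

/-! ### Weights -/

/-- The weights on `SegrePoly`: `a_A` has weight `1` and `s_A` has weight `-1` in the component
`A`. The range of `segre` is the weight zero part. -/
def wt (v : Fin 2 × Fin 2 × Fin 2) : Fin 2 → ℤ := Pi.single v.2.1 (if v.1 = 0 then 1 else -1)

/-- `g` has weight `m`. -/
abbrev HasWt (g : SegrePoly) (m : Fin 2 → ℤ) : Prop := IsWeightedHomogeneous wt g m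

lemma weight_wt (d : Fin 2 × Fin 2 × Fin 2 →₀ ℕ) (A : Fin 2) : Finsupp.weight wt d A =
    d (0, A, 0) + d (0, A, 1) - d (1, A, 0) - d (1, A, 1) := by
  rw [Finsupp.weight_apply, Finsupp.sum_fintype _ _ (fun _ => by exact zero_nsmul _)]
  fin_cases A <;> simp [Fintype.sum_prod_type, Fin.sum_univ_two, wt] <;> ring

lemma hasWt_segre (r : XiPoly) : HasWt (segre r) 0 := by
  induction r using MvPolynomial.induction_on' with
  | monomial m c =>
    rw [monomial_eq_smul_mono, map_smul, segre_mono, mono_eq_monomial, smul_monomial]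
    apply isWeightedHomogeneous_monomial
    ext A
    simp [weight_wt, segreExp]
    ring
  | add p q hp hq =>
    rw [map_add]
    exact hp.add hq

lemma exists_segre_eq {g : SegrePoly} (hg : HasWt g 0) : ∃ r, segre r = g := by
  induction hg using IsWeightedHomogeneous.induction_on with
  | zero => exact ⟨0, map_zero _⟩
  | add p q _ _ hp hq =>
    obtain ⟨r, rfl⟩ := hp
    obtain ⟨s, rfl⟩ := hq
    exact ⟨r + s, map_add _ _ _⟩
  | monomial d c hd =>
    refine ⟨c • mono (sectionExp d), ?_⟩
    rw [map_smul, segre_mono, monomial_eq_smul_mono]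
    congr 2
    funext ⟨k, A, i⟩
    have hA := congrFun hd A
    rw [weight_wt, Pi.zero_apply] at hA
    fin_cases k <;> fin_cases i <;> simp [segreExp, sectionExp] <;> omega

/-- A polynomial of negative weight is in the ideal `(s_0, s_1)`. -/
lemma exists_of_neg (A : Fin 2) {g : SegrePoly} {m n : Fin 2 → ℤ} (hg : HasWt g m) (hm : m A < 0)
    (hn : n = m + Pi.single A 1) :
    ∃ g₀ g₁, HasWt g₀ n ∧ HasWt g₁ n ∧ g = X (1, A, 0) * g₀ + X (1, A, 1) * g₁ := by
  induction hg using IsWeightedHomogeneous.induction_on with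
  | zero => exact ⟨0, 0, isWeightedHomogeneous_zero _ _ _, isWeightedHomogeneous_zero _ _ _, by simp⟩
  | add p q _ _ hp hq =>
    obtain ⟨p₀, p₁, h0, h1, rfl⟩ := hp
    obtain ⟨q₀, q₁, h2, h3, rfl⟩ := hq
    exact ⟨p₀ + q₀, p₁ + q₁, h0.add h2, h1.add h3, by ring⟩
  | monomial d c hd =>
    have key : ∀ i, d (1, A, i) ≠ 0 → ∃ g₀, HasWt g₀ n ∧ monomial d c = X (1, A, i) * g₀ := by
      intro i hdv
      have hle : Finsupp.single (1, A, i) 1 ≤ d := by simpa [Nat.one_le_iff_ne_zero] using hdv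
      refine ⟨monomial (d - Finsupp.single (1, A, i) 1) c, ?_, ?_⟩
      · apply isWeightedHomogeneous_monomial
        rw [hn, ← hd]
        nth_rw 2 [← tsub_add_cancel_of_le hle]
        rw [map_add, Finsupp.weight_single]
        simp [wt, add_assoc, ← Pi.single_add]
      · rw [X, monomial_mul, one_mul, add_tsub_cancel_of_le hle]
    by_cases h : d (1, A, 0) = 0
    · obtain ⟨g₁, h1, h2⟩ := key 1 (by
        intro h'
        rw [← hd, weight_wt, h, h'] at hm
        omega)
      exact ⟨0, g₁, isWeightedHomogeneous_zero _ _ _, h1, by rw [h2]; ring⟩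
    · obtain ⟨g₀, h1, h2⟩ := key 0 h
      exact ⟨g₀, 0, h1, isWeightedHomogeneous_zero _ _ _, by rw [h2]; ring⟩

/-- The component of weight `n`. -/
abbrev wtComp (n : Fin 2 → ℤ) : SegrePoly →ₗ[ℂ] SegrePoly := weightedHomogeneousComponent wt n

/-- Used to cut polynomial solutions of homogeneous equations down to the required weight. -/
lemma wtComp_mul {z : SegrePoly} {m : Fin 2 → ℤ} (hz : HasWt z m) (n k : Fin 2 → ℤ) (hk : n + m = k)
    (g : SegrePoly) : wtComp k (g * z) = wtComp n g * z := by
  subst hk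
  induction g using MvPolynomial.induction_on' with
  | monomial d c =>
    have h1 := isWeightedHomogeneous_monomial wt d c rfl
    rw [weightedHomogeneousComponent_of_mem h1, weightedHomogeneousComponent_of_mem (h1.mul hz)]
    simp
  | add p q hp hq => rw [add_mul, map_add, hp, hq, map_add, add_mul]

/-! ### Regularity -/

/-- The minor is linear in `xi 1 (A, 1)`, with coefficient `xi 0 (A, 0)` coprime to the remaining
term; it is therefore irreducible, hence prime in this factorial ring. -/
lemma prime_minor (A : Fin 2) : Prime (minor (A, 0) (A, 1)) := by
  have hX : ∀ v, Prime (X v : XiPoly) := fun v => MvPolynomial.X_prime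
  have hndvd : ∀ v w : Fin 2 × SpinorIdx, v ≠ w → ¬ (X v : XiPoly) ∣ X w := by
    intro v w hvw h
    rw [X_dvd_X] at h
    simp_all
  rw [← UniqueFactorizationMonoid.irreducible_iff_prime]
  have := irreducible_mul_X_add (X (0, (A, 0)) : XiPoly) (-(X (0, (A, 1)) * X (1, (A, 0))))
    (1, (A, 1)) (X_ne_zero _) (by simp) (by
      rw [vars_neg]
      intro h
      have := vars_mul _ _ h
      simp at this) (by
      rw [IsRelPrime.neg_right_iff, (hX _).irreducible.isRelPrime_iff_not_dvd]
      intro h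
      rcases (hX _).dvd_or_dvd h with h | h
      · exact hndvd _ _ (by simp) h
      · exact hndvd _ _ (by simp) h)
  rw [← sub_eq_add_neg] at this
  exact this

lemma minor_regular {m n : XiPoly}
    (h : minor (0, 0) (0, 1) * m = minor (1, 0) (1, 1) * n) :
    ∃ r, m = minor (1, 0) (1, 1) * r := by
  have hdvd : minor (1, 0) (1, 1) ∣ minor (0, 0) (0, 1) * m := ⟨n, h⟩
  refine ((prime_minor 1).dvd_or_dvd hdvd).resolve_left ?_
  rintro ⟨r, hr⟩
  -- At the point where block `0` is the identity and block `1` is zero, the first minor is `1` and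
  -- the second vanishes.
  have := congrArg (eval fun v : Fin 2 × SpinorIdx =>
    if v.2.1 = 0 ∧ v.1 = v.2.2 then (1 : ℂ) else 0) hr
  simp [minor, xi] at this

lemma minor_ne_zero (A : Fin 2) : minor (A, 0) (A, 1) ≠ 0 := (prime_minor A).ne_zero

/-! ### Syzygies -/

/-- Substitute zero for two of the variables. -/
def kill (u v : Fin 2 × Fin 2 × Fin 2) : SegrePoly →ₐ[ℂ] SegrePoly :=
  aeval fun w => if w = u ∨ w = v then 0 else X w

lemma kill_X (u v w : Fin 2 × Fin 2 × Fin 2) :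
    kill u v (X w) = if w = u ∨ w = v then 0 else X w := by simp [kill]

lemma exists_eq_kill_add (u v : Fin 2 × Fin 2 × Fin 2) (p : SegrePoly) :
    ∃ p₁ p₂, p = kill u v p + X u * p₁ + X v * p₂ := by
  induction p using MvPolynomial.induction_on with
  | C c => exact ⟨0, 0, by simp [kill]⟩
  | add p q hp hq =>
    obtain ⟨p₁, p₂, hp⟩ := hp
    obtain ⟨q₁, q₂, hq⟩ := hq
    exact ⟨p₁ + q₁, p₂ + q₂, by rw [map_add]; linear_combination hp + hq⟩
  | mul_X p w hp =>
    obtain ⟨p₁, p₂, hp⟩ := hp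
    rw [map_mul, kill_X]
    by_cases hu : w = u
    · exact ⟨p, 0, by simp [hu, mul_comm]⟩
    by_cases hv : w = v
    · exact ⟨0, p, by simp [hv, mul_comm]⟩
    · refine ⟨p₁ * X w, p₂ * X w, ?_⟩
      simp only [hu, hv, or_self, if_false]
      linear_combination X w * hp

lemma exists_eq_X_mul {u v w : Fin 2 × Fin 2 × Fin 2} (hv : u ≠ v) (hw : u ≠ w) {p q : SegrePoly}
    (h : p * (X v * X w) = X u * q) : ∃ r, p = X u * r := by
  have hX : Prime (X u : SegrePoly) := MvPolynomial.X_prime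
  have hd : (X u : SegrePoly) ∣ p * (X v * X w) := ⟨q, h⟩
  rcases hX.dvd_or_dvd hd with h | h
  · exact h
  · rcases hX.dvd_or_dvd h with h | h <;> rw [X_dvd_X] at h <;> simp_all

lemma exists_of_mul_eq_mul {p q : SegrePoly} (h : p * (X (0, 0, 0) * X (0, 1, 0)) =
    q * (X (0, 0, 1) * X (0, 1, 1))) :
    ∃ r, p = X (0, 0, 1) * X (0, 1, 1) * r ∧ q = X (0, 0, 0) * X (0, 1, 0) * r := by
  obtain ⟨p₁, rfl⟩ : ∃ p₁, p = X (0, 0, 1) * p₁ :=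
    exists_eq_X_mul (v := (0, 0, 0)) (w := (0, 1, 0)) (q := X (0, 1, 1) * q) (by simp) (by simp) (by rw [h]; ring)
  have h1 : p₁ * (X (0, 0, 0) * X (0, 1, 0)) = X (0, 1, 1) * q :=
    mul_left_cancel₀ (X_ne_zero (0, 0, 1)) (by linear_combination h)
  obtain ⟨r, rfl⟩ := exists_eq_X_mul (v := (0, 0, 0)) (w := (0, 1, 0)) (by simp) (by simp) h1
  exact ⟨r, by ring, mul_left_cancel₀ (X_ne_zero (0, 1, 1)) (by linear_combination -h1)⟩

/-- The syzygies of `(a a', b b', a b' + b a')`. -/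
lemma exists_syzygy {p q r : SegrePoly} (h : p * (X (0, 0, 0) * X (0, 1, 0)) +
    q * (X (0, 0, 1) * X (0, 1, 1)) +
    r * (X (0, 0, 0) * X (0, 1, 1) + X (0, 0, 1) * X (0, 1, 0)) = 0) :
    ∃ l₁ l₂ m₁ m₂ m₃,
      p = l₁ * -(X (0, 0, 1) ^ 2) + l₂ * -(X (0, 1, 1) ^ 2)
        + m₁ * -(X (0, 0, 0) * X (0, 1, 1) + X (0, 0, 1) * X (0, 1, 0))
        + m₃ * (X (0, 0, 1) * X (0, 1, 1)) ∧
      q = l₁ * -(X (0, 0, 0) ^ 2) + l₂ * -(X (0, 1, 0) ^ 2)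
        + m₂ * -(X (0, 0, 0) * X (0, 1, 1) + X (0, 0, 1) * X (0, 1, 0))
        + m₃ * -(X (0, 0, 0) * X (0, 1, 0)) ∧
      r = l₁ * (X (0, 0, 0) * X (0, 0, 1)) + l₂ * (X (0, 1, 0) * X (0, 1, 1))
        + m₁ * (X (0, 0, 0) * X (0, 1, 0)) + m₂ * (X (0, 0, 1) * X (0, 1, 1)) := by
  -- Modulo `(a, b')` the relation reads `r·ba' = 0`, and modulo `(b, a')` it reads `r·ab' = 0`. So
  -- `r` lies in both ideals, hence in their product, spanned by `ab, aa', bb', a'b'`. Each of these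
  -- is the third entry of a listed syzygy; subtracting them leaves a relation between `aa'` and
  -- `bb'` only.
  have h1 : kill (0, 0, 0) (0, 1, 1) r = 0 := by
    have := congrArg (kill (0, 0, 0) (0, 1, 1)) h
    simpa [kill_X] using this
  have h2 : kill (0, 0, 1) (0, 1, 0) r = 0 := by
    have := congrArg (kill (0, 0, 1) (0, 1, 0)) h
    simpa [kill_X] using this
  obtain ⟨r₁, r₂, hr⟩ := exists_eq_kill_add (0, 0, 0) (0, 1, 1) r
  rw [h1, zero_add] at hr
  obtain ⟨r₁₁, r₁₂, hr₁⟩ := exists_eq_kill_add (0, 0, 1) (0, 1, 0) r₁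
  obtain ⟨r₂₁, r₂₂, hr₂⟩ := exists_eq_kill_add (0, 0, 1) (0, 1, 0) r₂
  -- Since `r` vanishes modulo `(b, a')`, the remainders of `r₁` and `r₂` cancel against each other.
  have h3 := congrArg (kill (0, 0, 1) (0, 1, 0)) hr
  simp only [h2, map_add, map_mul, kill_X] at h3
  simp at h3
  have hr' : r = X (0, 0, 0) * (X (0, 0, 1) * r₁₁ + X (0, 1, 0) * r₁₂) +
      X (0, 1, 1) * (X (0, 0, 1) * r₂₁ + X (0, 1, 0) * r₂₂) := by
    linear_combination hr + X (0, 0, 0) * hr₁ + X (0, 1, 1) * hr₂ - h3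
  obtain ⟨m, hm₁, hm₂⟩ := exists_of_mul_eq_mul
    (p := p + r₁₁ * X (0, 0, 1) ^ 2 + r₂₂ * X (0, 1, 1) ^ 2
      + r₁₂ * (X (0, 0, 0) * X (0, 1, 1) + X (0, 0, 1) * X (0, 1, 0)))
    (q := -(q + r₁₁ * X (0, 0, 0) ^ 2 + r₂₂ * X (0, 1, 0) ^ 2
      + r₂₁ * (X (0, 0, 0) * X (0, 1, 1) + X (0, 0, 1) * X (0, 1, 0)))) (by
    linear_combination h - (X (0, 0, 0) * X (0, 1, 1) + X (0, 0, 1) * X (0, 1, 0)) * hr')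
  refine ⟨r₁₁, r₂₂, r₁₂, r₂₁, m, ?_, ?_, ?_⟩
  · linear_combination hm₁
  · linear_combination -hm₂
  · linear_combination hr'

/-! ### Syzygies with prescribed weights. -/

lemma hasWt_a (A α : Fin 2) : HasWt (X (0, A, α)) (Pi.single A 1) :=
  isWeightedHomogeneous_X _ _ _

lemma wtComp_of_hasWt {g : SegrePoly} {m : Fin 2 → ℤ} (hg : HasWt g m) : wtComp m g = g :=
  hg.weightedHomogeneousComponent_same

lemma hasWt_wtComp (g : SegrePoly) (m : Fin 2 → ℤ) : HasWt (wtComp m g) m :=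
  weightedHomogeneousComponent_isWeightedHomogeneous m g

/-- Extract one `s_0` and one `s_1`, then split the four products `s_{0,i} s_{1,j}` into symmetric
and antisymmetric parts. The latter is the factor `D` of the quadrics and will yield coboundaries.
-/
lemma exists_of_hasWt_neg_neg {g : SegrePoly} (hg : HasWt g ![-1, -1]) :
    ∃ r₁ r₂ r₃ h : XiPoly, g = X (1, 0, 0) * X (1, 1, 0) * segre r₁
      + C (1 / 2) * (X (1, 0, 0) * X (1, 1, 1) + X (1, 0, 1) * X (1, 1, 0)) * segre r₂
      + X (1, 0, 1) * X (1, 1, 1) * segre r₃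
      + (X (1, 0, 0) * X (1, 1, 1) - X (1, 0, 1) * X (1, 1, 0)) * segre h := by
  obtain ⟨g₀, g₁, h₀, h₁, rfl⟩ := exists_of_neg 0 hg (by simp) (n := ![0, -1])
    (by ext i; fin_cases i <;> simp)
  obtain ⟨p, q, hp, hq, rfl⟩ := exists_of_neg 1 h₀ (by simp) (n := 0)
    (by ext i; fin_cases i <;> simp)
  obtain ⟨r, k, hr, hk, rfl⟩ := exists_of_neg 1 h₁ (by simp) (n := 0)
    (by ext i; fin_cases i <;> simp)
  obtain ⟨p, rfl⟩ := exists_segre_eq hp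
  obtain ⟨q, rfl⟩ := exists_segre_eq hq
  obtain ⟨r, rfl⟩ := exists_segre_eq hr
  obtain ⟨k, rfl⟩ := exists_segre_eq hk
  have half : (C (1 / 2) : SegrePoly) * 2 = 1 := by
    rw [show (2 : SegrePoly) = C 2 from (map_ofNat C 2).symm, ← C_mul]; simp
  have half' : segre (C (1 / 2)) = C (1 / 2) := segre.commutes _
  refine ⟨p, q + r, k, C (1 / 2) * (q - r), ?_⟩
  simp only [map_add, map_sub, map_mul, half']
  linear_combination -(X (1, 0, 0) * X (1, 1, 1) * segre q + X (1, 0, 1) * X (1, 1, 0) * segre r)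
    * half

/-- Both extracted factors belong to the same block, so their product is symmetric and no term with
`D` occurs. -/
lemma exists_of_hasWt_neg_two (A : Fin 2) {g : SegrePoly} (hg : HasWt g (Pi.single A (-2))) :
    ∃ r₁ r₂ r₃ : XiPoly, g = X (1, A, 0) ^ 2 * segre r₁ + X (1, A, 0) * X (1, A, 1) * segre r₂
      + X (1, A, 1) ^ 2 * segre r₃ := by
  obtain ⟨g₀, g₁, h₀, h₁, rfl⟩ := exists_of_neg A hg (by simp) (n := Pi.single A (-1))
    (by rw [← Pi.single_add]; rfl)
  obtain ⟨p, q, hp, hq, rfl⟩ := exists_of_neg A h₀ (by simp) (n := 0)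
    (by rw [← Pi.single_add]; simp)
  obtain ⟨r, k, hr, hk, rfl⟩ := exists_of_neg A h₁ (by simp) (n := 0)
    (by rw [← Pi.single_add]; simp)
  obtain ⟨p, rfl⟩ := exists_segre_eq hp
  obtain ⟨q, rfl⟩ := exists_segre_eq hq
  obtain ⟨r, rfl⟩ := exists_segre_eq hr
  obtain ⟨k, rfl⟩ := exists_segre_eq hk
  exact ⟨p, q + r, k, by rw [map_add]; ring⟩

lemma hasWt_aa (α β : Fin 2) : HasWt (X (0, 0, α) * X (0, 1, β)) ![1, 1] := by
  have := (hasWt_a 0 α).mul (hasWt_a 1 β)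
  convert this using 1
  ext i; fin_cases i <;> simp

lemma hasWt_aa' (A α β : Fin 2) : HasWt (X (0, A, α) * X (0, A, β)) (Pi.single A 2) := by
  have := (hasWt_a A α).mul (hasWt_a A β)
  rwa [← Pi.single_add] at this

/-- Koszul cycles of degree two. -/
lemma exists_koszul_two {p q r : SegrePoly} (hp : HasWt p 0) (hq : HasWt q 0) (hr : HasWt r 0)
    (h₁ : p * (X (0, 0, 0) * X (0, 1, 0)) = q * (X (0, 0, 1) * X (0, 1, 1)))
    (h₂ : r * (X (0, 0, 1) * X (0, 1, 1)) =
      p * (X (0, 0, 0) * X (0, 1, 1) + X (0, 0, 1) * X (0, 1, 0))) :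
    ∃ g, HasWt g ![-1, -1] ∧ p = g * (X (0, 0, 1) * X (0, 1, 1)) ∧
      q = g * (X (0, 0, 0) * X (0, 1, 0)) ∧
      r = g * (X (0, 0, 0) * X (0, 1, 1) + X (0, 0, 1) * X (0, 1, 0)) := by
  obtain ⟨g, rfl, rfl⟩ := exists_of_mul_eq_mul h₁
  have hr' : r = g * (X (0, 0, 0) * X (0, 1, 1) + X (0, 0, 1) * X (0, 1, 0)) := by
    refine mul_left_cancel₀ (mul_ne_zero (X_ne_zero (0, 0, 1)) (X_ne_zero (0, 1, 1))) ?_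
    linear_combination h₂
  refine ⟨wtComp ![-1, -1] g, hasWt_wtComp _ _, ?_, ?_, ?_⟩
  · rw [← wtComp_mul (hasWt_aa 1 1) _ 0 (by ext i; fin_cases i <;> simp), mul_comm g,
      wtComp_of_hasWt hp]
  · rw [← wtComp_mul (hasWt_aa 0 0) _ 0 (by ext i; fin_cases i <;> simp), mul_comm g,
      wtComp_of_hasWt hq]
  · rw [← wtComp_mul ((hasWt_aa 0 1).add (hasWt_aa 1 0)) _ 0 (by ext i; fin_cases i <;> simp),
      ← hr', wtComp_of_hasWt hr]

/-- The syzygies of `(a a', b b', a b' + b a')` of weight zero. -/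
lemma exists_syzygy_hasWt {p q r : SegrePoly} (hp : HasWt p 0) (hq : HasWt q 0) (hr : HasWt r 0)
    (h : p * (X (0, 0, 0) * X (0, 1, 0)) + q * (X (0, 0, 1) * X (0, 1, 1)) +
      r * (X (0, 0, 0) * X (0, 1, 1) + X (0, 0, 1) * X (0, 1, 0)) = 0) :
    ∃ l₁ l₂ m₁ m₂ m₃, HasWt l₁ (Pi.single 0 (-2)) ∧ HasWt l₂ (Pi.single 1 (-2)) ∧
      HasWt m₁ ![-1, -1] ∧ HasWt m₂ ![-1, -1] ∧ HasWt m₃ ![-1, -1] ∧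
      p = l₁ * -(X (0, 0, 1) ^ 2) + l₂ * -(X (0, 1, 1) ^ 2)
        + m₁ * -(X (0, 0, 0) * X (0, 1, 1) + X (0, 0, 1) * X (0, 1, 0))
        + m₃ * (X (0, 0, 1) * X (0, 1, 1)) ∧
      q = l₁ * -(X (0, 0, 0) ^ 2) + l₂ * -(X (0, 1, 0) ^ 2)
        + m₂ * -(X (0, 0, 0) * X (0, 1, 1) + X (0, 0, 1) * X (0, 1, 0))
        + m₃ * -(X (0, 0, 0) * X (0, 1, 0)) ∧
      r = l₁ * (X (0, 0, 0) * X (0, 0, 1)) + l₂ * (X (0, 1, 0) * X (0, 1, 1))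
        + m₁ * (X (0, 0, 0) * X (0, 1, 0)) + m₂ * (X (0, 0, 1) * X (0, 1, 1)) := by
  obtain ⟨l₁, l₂, m₁, m₂, m₃, ep, eq, er⟩ := exists_syzygy h
  -- Taking the weight zero component of each identity replaces every multiplier by its component of
  -- complementary weight.
  have w0 : ∀ α β g, wtComp 0 (g * (X (0, 0, α) * X (0, 0, β)))
      = wtComp (Pi.single 0 (-2)) g * (X (0, 0, α) * X (0, 0, β)) := fun α β =>
    wtComp_mul (hasWt_aa' 0 α β) _ 0 (by rw [← Pi.single_add]; simp)
  have w1 : ∀ α β g, wtComp 0 (g * (X (0, 1, α) * X (0, 1, β)))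
      = wtComp (Pi.single 1 (-2)) g * (X (0, 1, α) * X (0, 1, β)) := fun α β =>
    wtComp_mul (hasWt_aa' 1 α β) _ 0 (by rw [← Pi.single_add]; simp)
  have w2 : ∀ α β g, wtComp 0 (g * (X (0, 0, α) * X (0, 1, β)))
      = wtComp ![-1, -1] g * (X (0, 0, α) * X (0, 1, β)) := fun α β =>
    wtComp_mul (hasWt_aa α β) _ 0 (by ext i; fin_cases i <;> simp)
  refine ⟨wtComp _ l₁, wtComp _ l₂, wtComp _ m₁, wtComp _ m₂, wtComp _ m₃, hasWt_wtComp _ _,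
    hasWt_wtComp _ _, hasWt_wtComp _ _, hasWt_wtComp _ _, hasWt_wtComp _ _, ?_, ?_, ?_⟩
  · have := congrArg (wtComp 0) ep
    simpa only [wtComp_of_hasWt hp, map_add, map_neg, mul_neg, mul_add, sq, w0, w1, w2] using this
  · have := congrArg (wtComp 0) eq
    simpa only [wtComp_of_hasWt hq, map_add, map_neg, mul_neg, mul_add, sq, w0, w1, w2] using this
  · have := congrArg (wtComp 0) er
    simpa only [wtComp_of_hasWt hr, map_add, map_neg, mul_neg, mul_add, sq, w0, w1, w2] using this

/-! ### The Koszul complex of three quadrics modulo the other two -/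

/-- Coefficients of `1, e₀; e₁, e₁ e₀; e₂, e₂ e₀; e₂ e₁, e₂ e₁ e₀`. -/
abbrev Kosz3 : Type :=
  ((XiPoly × XiPoly) × (XiPoly × XiPoly)) × ((XiPoly × XiPoly) × (XiPoly × XiPoly))

variable (ψ : XiPoly ≃ₐ[ℂ] XiPoly)

/-- Five linear combinations of minors which span the same space as the coefficients of the
coboundary operator. -/
def quad : Fin 5 → XiPoly :=
  ![minor (0, 0) (1, 0), minor (0, 1) (1, 1), minor (0, 0) (1, 1) + minor (0, 1) (1, 0),
    minor (0, 0) (0, 1), minor (1, 0) (1, 1)]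

/-- The Koszul differential with `d e_k = ψ (quad k)`. -/
def kosz3 : Kosz3 →ₗ[XiPoly] Kosz3 :=
  cone (cone (cone 0 (ψ (quad 0))) (ψ (quad 1))) (ψ (quad 2))

lemma kosz3_kosz3 (m : Kosz3) : kosz3 ψ (kosz3 ψ m) = 0 := by
  obtain ⟨⟨⟨x, x₀⟩, x₁, x₀₁⟩, ⟨x₂, x₀₂⟩, x₁₂, x₀₁₂⟩ := m
  simp only [kosz3, cone_apply, Prod.ext_iff, Prod.fst_add, Prod.snd_add, Prod.smul_fst,
    Prod.smul_snd, Prod.fst_neg, Prod.snd_neg, Prod.fst_zero, Prod.snd_zero, LinearMap.zero_apply,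
    smul_eq_mul]
  refine ⟨⟨⟨?_, ?_⟩, ?_, ?_⟩, ⟨?_, ?_⟩, ?_, ?_⟩ <;> ring

/-- The symmetrized product of `ξ_i^v` and `ξ_j^w`. -/
def sym (v w : SpinorIdx) (i j : Fin 2) : XiPoly :=
  C (1 / 2) * (xi i v * xi j w + xi j v * xi i w)

/-- The combination of the symmetrized products for `(i, j) = (1, 1), (1, 2), (2, 2)`. -/
def symSum (v w : SpinorIdx) (l : Fin 3 → XiPoly) : XiPoly :=
  l 0 * ψ (sym v w 0 0) + l 1 * ψ (sym v w 0 1) + l 2 * ψ (sym v w 1 1)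

/-- The part free of `e₃` and `e₄` of the cocycles in positive degree. -/
def cocycle3 (l₁ l₂ m₁ m₂ m₃ n : Fin 3 → XiPoly) : Kosz3 :=
  (((0,
    -symSum ψ (0, 1) (0, 1) l₁ - symSum ψ (1, 1) (1, 1) l₂
      - (symSum ψ (0, 0) (1, 1) m₁ + symSum ψ (0, 1) (1, 0) m₁) + symSum ψ (0, 1) (1, 1) m₃),
    (-symSum ψ (0, 0) (0, 0) l₁ - symSum ψ (1, 0) (1, 0) l₂
      - (symSum ψ (0, 0) (1, 1) m₂ + symSum ψ (0, 1) (1, 0) m₂) - symSum ψ (0, 0) (1, 0) m₃,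
    symSum ψ (0, 0) (1, 1) n + symSum ψ (0, 1) (1, 0) n)),
    ((symSum ψ (0, 0) (0, 1) l₁ + symSum ψ (1, 0) (1, 1) l₂
      + symSum ψ (0, 0) (1, 0) m₁ + symSum ψ (0, 1) (1, 1) m₂,
    -symSum ψ (0, 1) (1, 1) n),
    (symSum ψ (0, 0) (1, 0) n, 0)))

/-- The parametrization in the variables `ψ (ξ)`. -/
def segreψ : XiPoly →ₐ[ℂ] SegrePoly := segre.comp ψ.symm.toAlgHom

lemma segreψ_apply (r : XiPoly) : segreψ ψ (ψ r) = segre r := by simp [segreψ]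

lemma exists_of_segreψ_eq {r s : XiPoly} (hr : segreψ ψ r = segreψ ψ s) :
    ∃ β γ, r = s + ψ (quad 3) * β + ψ (quad 4) * γ := by
  have h : segre (ψ.symm (r - s)) = 0 := by
    rw [← sub_eq_zero, ← map_sub] at hr
    exact hr
  obtain ⟨β, γ, h⟩ := exists_of_segre_eq_zero h
  refine ⟨ψ β, ψ γ, ?_⟩
  have := congrArg ψ h
  simp only [AlgEquiv.apply_symm_apply, map_add, map_mul] at this
  simp only [quad, Matrix.cons_val]
  linear_combination this

lemma hasWt_segreψ (r : XiPoly) : HasWt (segreψ ψ r) 0 := hasWt_segre _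

lemma segre_half : segre (C (1 / 2)) = C (1 / 2) := segre.commutes _

lemma C_half_mul_two {σ : Type*} : (C (1 / 2) : MvPolynomial σ ℂ) * 2 = 1 := by
  rw [show (2 : MvPolynomial σ ℂ) = C 2 from (map_ofNat C 2).symm, ← C_mul]; simp

/-- On rank one blocks a minor mixing the blocks factors into an `a`-part and the common
`s`-determinant; a minor inside one block vanishes. -/
lemma segre_quad (k : Fin 5) : segre (quad k) =
    (X (1, 0, 0) * X (1, 1, 1) - X (1, 0, 1) * X (1, 1, 0)) *
      (![X (0, 0, 0) * X (0, 1, 0), X (0, 0, 1) * X (0, 1, 1),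
        X (0, 0, 0) * X (0, 1, 1) + X (0, 0, 1) * X (0, 1, 0), 0, 0] : Fin 5 → SegrePoly) k := by
  fin_cases k <;> simp [quad, minor] <;> ring

/-- Matches `symSum` with the normal forms of multipliers of negative weight, which lifts syzygies
back to polynomials in the `ξ`. -/
lemma segreψ_symSum (v w : SpinorIdx) (l : Fin 3 → XiPoly) :
    segreψ ψ (symSum ψ v w l) = X (0, v.1, v.2) * X (0, w.1, w.2) *
      (X (1, v.1, 0) * X (1, w.1, 0) * segreψ ψ (l 0)
        + C (1 / 2) * (X (1, v.1, 0) * X (1, w.1, 1) + X (1, v.1, 1) * X (1, w.1, 0))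
          * segreψ ψ (l 1)
        + X (1, v.1, 1) * X (1, w.1, 1) * segreψ ψ (l 2)) := by
  simp only [symSum, map_add, map_mul, segreψ_apply, sym, segre_half, segre_xi]
  linear_combination (X (0, v.1, v.2) * X (0, w.1, w.2) *
      (X (1, v.1, 0) * X (1, w.1, 0) * segreψ ψ (l 0)
        + X (1, v.1, 1) * X (1, w.1, 1) * segreψ ψ (l 2))) * C_half_mul_two

lemma segre_disc_ne_zero :
    (X (1, 0, 0) * X (1, 1, 1) - X (1, 0, 1) * X (1, 1, 0) : SegrePoly) ≠ 0 := by
  intro h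
  have := congrArg (eval fun v : Fin 2 × Fin 2 × Fin 2 =>
    if v.2.1 = v.2.2 then (1 : ℂ) else 0) h
  simp at this

lemma exists_segreψ_of_hasWt_neg_neg {g : SegrePoly} (hg : HasWt g ![-1, -1]) :
    ∃ (l : Fin 3 → XiPoly) (h : XiPoly), g = X (1, 0, 0) * X (1, 1, 0) * segreψ ψ (l 0)
      + C (1 / 2) * (X (1, 0, 0) * X (1, 1, 1) + X (1, 0, 1) * X (1, 1, 0)) * segreψ ψ (l 1)
      + X (1, 0, 1) * X (1, 1, 1) * segreψ ψ (l 2)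
      + (X (1, 0, 0) * X (1, 1, 1) - X (1, 0, 1) * X (1, 1, 0)) * segreψ ψ h := by
  obtain ⟨r₁, r₂, r₃, h, e⟩ := exists_of_hasWt_neg_neg hg
  exact ⟨![ψ r₁, ψ r₂, ψ r₃], ψ h, by simpa only [Matrix.cons_val, segreψ_apply] using e⟩

lemma exists_segreψ_of_hasWt_neg_two (A : Fin 2) {g : SegrePoly}
    (hg : HasWt g (Pi.single A (-2))) :
    ∃ l : Fin 3 → XiPoly, g = X (1, A, 0) * X (1, A, 0) * segreψ ψ (l 0)
      + C (1 / 2) * (X (1, A, 0) * X (1, A, 1) + X (1, A, 1) * X (1, A, 0)) * segreψ ψ (l 1)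
      + X (1, A, 1) * X (1, A, 1) * segreψ ψ (l 2) := by
  obtain ⟨r₁, r₂, r₃, e⟩ := exists_of_hasWt_neg_two A hg
  refine ⟨![ψ r₁, ψ r₂, ψ r₃], ?_⟩
  simp only [Matrix.cons_val, segreψ_apply]
  linear_combination e - X (1, A, 0) * X (1, A, 1) * segre r₂ * C_half_mul_two

lemma kosz3_degree_two (k₀₁ k₀₂ k₁₂ k : XiPoly) :
    kosz3 ψ (((0, 0), (0, k₀₁)), ((0, k₀₂), (k₁₂, k))) =
      (((0, ψ (quad 1) * k₀₁ + ψ (quad 2) * k₀₂),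
        (-(ψ (quad 0) * k₀₁) + ψ (quad 2) * k₁₂, ψ (quad 2) * k)),
        ((-(ψ (quad 0) * k₀₂) - ψ (quad 1) * k₁₂, -(ψ (quad 1) * k)), (ψ (quad 0) * k, 0))) := by
  simp only [kosz3, cone_apply, Prod.ext_iff, Prod.fst_add, Prod.snd_add, Prod.smul_fst,
    Prod.smul_snd, Prod.fst_neg, Prod.snd_neg, LinearMap.zero_apply, smul_eq_mul]
  refine ⟨⟨⟨?_, ?_⟩, ?_, ?_⟩, ⟨?_, ?_⟩, ?_, ?_⟩ <;> ring

/-- After applying `segreψ`, which kills `quad 3` and `quad 4`, one cancels `D` and solves degree by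
degree. The solution is lifted componentwise, and the ambiguity of the lifts is exactly the `ζ, ξ`
terms. Degree zero is unconstrained and leaves `x`. -/
lemma kosz3_exact (α β γ : Kosz3)
    (h : kosz3 ψ α = ψ (quad 3) • β + ψ (quad 4) • γ) :
    ∃ x l₁ l₂ m₁ m₂ m₃ n η ζ ξ, α = kosz3 ψ η + ψ (quad 3) • ζ + ψ (quad 4) • ξ
      + ((((x, 0), 0), 0) + cocycle3 ψ l₁ l₂ m₁ m₂ m₃ n) := by
  obtain ⟨⟨⟨x, x₀⟩, x₁, x₀₁⟩, ⟨x₂, x₀₂⟩, x₁₂, x₀₁₂⟩ := α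
  have h' := congrArg (Prod.map (Prod.map (Prod.map (segreψ ψ) (segreψ ψ))
    (Prod.map (segreψ ψ) (segreψ ψ))) (Prod.map (Prod.map (segreψ ψ) (segreψ ψ))
    (Prod.map (segreψ ψ) (segreψ ψ)))) h
  simp only [kosz3, cone_apply, Prod.ext_iff, Prod.fst_add, Prod.snd_add, Prod.smul_fst,
    Prod.smul_snd, Prod.fst_neg, Prod.snd_neg, LinearMap.zero_apply,
    smul_eq_mul, Prod.map_fst, Prod.map_snd, map_add, map_mul, map_neg, map_zero, segreψ_apply,
    segre_quad, Matrix.cons_val, zero_mul, mul_zero, add_zero, zero_add, neg_neg] at h'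
  obtain ⟨⟨⟨h0, h1⟩, -, -⟩, ⟨h3, -⟩, h5, -⟩ := h'
  have hD := segre_disc_ne_zero
  set D : SegrePoly := X (1, 0, 0) * X (1, 1, 1) - X (1, 0, 1) * X (1, 1, 0)
  -- In top degree the differential is injective on the domain `SegrePoly`.
  have e2 : segreψ ψ x₀₁₂ = segreψ ψ 0 := by
    rw [map_zero]
    refine (mul_eq_zero.1 h5).resolve_left (mul_ne_zero hD ?_)
    exact mul_ne_zero (X_ne_zero _) (X_ne_zero _)
  obtain ⟨g, hg, gp, gq, gr⟩ := exists_koszul_two (p := -segreψ ψ x₀₂) (q := segreψ ψ x₁₂)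
    (r := segreψ ψ x₀₁) (hasWt_segreψ ψ _).neg (hasWt_segreψ ψ _) (hasWt_segreψ ψ _)
    (mul_left_cancel₀ hD (by linear_combination h3)) (mul_left_cancel₀ hD (by
      linear_combination h1))
  obtain ⟨n, k, rfl⟩ := exists_segreψ_of_hasWt_neg_neg ψ hg
  obtain ⟨l₁, l₂, m₁, m₂, m₃, wl₁, wl₂, wm₁, wm₂, wm₃, e₀, e₁, e₂⟩ := exists_syzygy_hasWt
    (hasWt_segreψ ψ x₀) (hasWt_segreψ ψ x₁) (hasWt_segreψ ψ x₂)
    (mul_left_cancel₀ hD (by linear_combination h0))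
  obtain ⟨l₁, rfl⟩ := exists_segreψ_of_hasWt_neg_two ψ 0 wl₁
  obtain ⟨l₂, rfl⟩ := exists_segreψ_of_hasWt_neg_two ψ 1 wl₂
  obtain ⟨m₁, k₁, rfl⟩ := exists_segreψ_of_hasWt_neg_neg ψ wm₁
  obtain ⟨m₂, k₂, rfl⟩ := exists_segreψ_of_hasWt_neg_neg ψ wm₂
  obtain ⟨m₃, k₃, rfl⟩ := exists_segreψ_of_hasWt_neg_neg ψ wm₃
  -- The multiples of `D` in the multipliers, with coefficients `k₁, k₂, k₃, k`, are the boundary of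
  -- the chain inserted here; the symmetric parts make up `cocycle3`.
  obtain ⟨ζ₀, ξ₀, f₀⟩ := exists_of_segreψ_eq ψ (r := x₀) (s := (kosz3 ψ (((0, 0), (0, k₃)),
    ((0, -k₁), (-k₂, k))) + cocycle3 ψ l₁ l₂ m₁ m₂ m₃ n).1.1.2) (by
    simp only [kosz3_degree_two, cocycle3, Prod.fst_add, Prod.snd_add, map_add, map_sub, map_neg,
      map_mul, segreψ_symSum, segreψ_apply, segre_quad, Matrix.cons_val]
    linear_combination e₀)
  obtain ⟨ζ₁, ξ₁, f₁⟩ := exists_of_segreψ_eq ψ (r := x₁) (s := (kosz3 ψ (((0, 0), (0, k₃)),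
    ((0, -k₁), (-k₂, k))) + cocycle3 ψ l₁ l₂ m₁ m₂ m₃ n).1.2.1) (by
    simp only [kosz3_degree_two, cocycle3, Prod.fst_add, Prod.snd_add, map_add, map_sub, map_neg,
      map_mul, segreψ_symSum, segreψ_apply, segre_quad, Matrix.cons_val]
    linear_combination e₁)
  obtain ⟨ζ₂, ξ₂, f₂⟩ := exists_of_segreψ_eq ψ (r := x₂) (s := (kosz3 ψ (((0, 0), (0, k₃)),
    ((0, -k₁), (-k₂, k))) + cocycle3 ψ l₁ l₂ m₁ m₂ m₃ n).2.1.1) (by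
    simp only [kosz3_degree_two, cocycle3, Prod.fst_add, Prod.snd_add, map_add, map_sub, map_neg,
      map_mul, segreψ_symSum, segreψ_apply, segre_quad, Matrix.cons_val]
    linear_combination e₂)
  obtain ⟨ζ₀₁, ξ₀₁, f₀₁⟩ := exists_of_segreψ_eq ψ (r := x₀₁) (s := (kosz3 ψ (((0, 0), (0, k₃)),
    ((0, -k₁), (-k₂, k))) + cocycle3 ψ l₁ l₂ m₁ m₂ m₃ n).1.2.2) (by
    simp only [kosz3_degree_two, cocycle3, Prod.fst_add, Prod.snd_add, map_add, map_sub, map_neg,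
      map_mul, segreψ_symSum, segreψ_apply, segre_quad, Matrix.cons_val]
    linear_combination gr)
  obtain ⟨ζ₀₂, ξ₀₂, f₀₂⟩ := exists_of_segreψ_eq ψ (r := x₀₂) (s := (kosz3 ψ (((0, 0), (0, k₃)),
    ((0, -k₁), (-k₂, k))) + cocycle3 ψ l₁ l₂ m₁ m₂ m₃ n).2.1.2) (by
    simp only [kosz3_degree_two, cocycle3, Prod.fst_add, Prod.snd_add, map_add, map_sub, map_neg,
      map_mul, segreψ_symSum, segreψ_apply, segre_quad, Matrix.cons_val]
    linear_combination -gp)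
  obtain ⟨ζ₁₂, ξ₁₂, f₁₂⟩ := exists_of_segreψ_eq ψ (r := x₁₂) (s := (kosz3 ψ (((0, 0), (0, k₃)),
    ((0, -k₁), (-k₂, k))) + cocycle3 ψ l₁ l₂ m₁ m₂ m₃ n).2.2.1) (by
    simp only [kosz3_degree_two, cocycle3, Prod.fst_add, Prod.snd_add, map_add, map_sub, map_neg,
      map_mul, segreψ_symSum, segreψ_apply, segre_quad, Matrix.cons_val]
    linear_combination gq)
  obtain ⟨ζ₀₁₂, ξ₀₁₂, f₀₁₂⟩ := exists_of_segreψ_eq ψ e2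
  refine ⟨x, l₁, l₂, m₁, m₂, m₃, n, (((0, 0), (0, k₃)), ((0, -k₁), (-k₂, k))),
    (((0, ζ₀), ζ₁, ζ₀₁), (ζ₂, ζ₀₂), ζ₁₂, ζ₀₁₂), (((0, ξ₀), ξ₁, ξ₀₁), (ξ₂, ξ₀₂), ξ₁₂, ξ₀₁₂), ?_⟩
  simp only [kosz3_degree_two, cocycle3, Prod.fst_add, Prod.snd_add] at f₀ f₁ f₂ f₀₁ f₀₂ f₁₂
  simp only [kosz3_degree_two, cocycle3, Prod.ext_iff, Prod.fst_add, Prod.snd_add, Prod.smul_fst,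
    Prod.smul_snd, smul_eq_mul, Prod.fst_zero, Prod.snd_zero]
  refine ⟨⟨⟨?_, ?_⟩, ?_, ?_⟩, ⟨?_, ?_⟩, ?_, ?_⟩
  · ring
  · linear_combination f₀
  · linear_combination f₁
  · linear_combination f₀₁
  · linear_combination f₂
  · linear_combination f₀₂
  · linear_combination f₁₂
  · linear_combination f₀₁₂

/-! ### Linearity and covariance of bilinear expressions -/

/-- `bil` as a linear map. -/
def bilₗ (i j : Fin 2) : SpinorMatrix →ₗ[ℂ] XiPoly where
  toFun A := bil A i j
  map_add' A B := by simp [bil, add_mul, Finset.sum_add_distrib]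
  map_smul' c A := by
    simp [bil, MvPolynomial.smul_eq_C_mul, Finset.mul_sum, mul_assoc]

lemma bilₗ_apply (i j : Fin 2) (A : SpinorMatrix) : bilₗ i j A = bil A i j := rfl

/-- The substitution `ξ_i ↦ ξ_i S`. -/
def spinorHom (S : SpinorMatrix) : XiPoly →ₐ[ℂ] XiPoly :=
  aeval fun v => ∑ β, C (S β v.2) * xi v.1 β

lemma spinorHom_xi (S : SpinorMatrix) (i : Fin 2) (α : SpinorIdx) :
    spinorHom S (xi i α) = ∑ β, C (S β α) * xi i β := by simp [spinorHom, xi]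

lemma spinorHom_comp (S T : SpinorMatrix) :
    (spinorHom S).comp (spinorHom T) = spinorHom (S * T) := by
  ext1 ⟨i, α⟩
  change spinorHom S (spinorHom T (xi i α)) = spinorHom (S * T) (xi i α)
  simp only [spinorHom_xi, map_sum, map_mul, Finset.mul_sum, Matrix.mul_apply, Finset.sum_mul,
    algHom_C, algebraMap_eq]
  rw [Finset.sum_comm]
  refine Finset.sum_congr rfl fun β _ => Finset.sum_congr rfl fun δ _ => by ring

lemma spinorHom_one : spinorHom 1 = AlgHom.id ℂ XiPoly := by
  ext1 ⟨i, α⟩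
  change spinorHom 1 (xi i α) = xi i α
  simp [spinorHom_xi, Matrix.one_apply]

/-- The substitution `ξ_i ↦ ξ_i S⁻¹` as an automorphism. -/
def spinorEquiv (S : SpinorMatrix) (hS : IsUnit S) : XiPoly ≃ₐ[ℂ] XiPoly :=
  AlgEquiv.ofAlgHom (spinorHom S⁻¹) (spinorHom S)
    (by rw [spinorHom_comp, Matrix.nonsing_inv_mul _ ((Matrix.isUnit_iff_isUnit_det _).1 hS),
      spinorHom_one])
    (by rw [spinorHom_comp, Matrix.mul_nonsing_inv _ ((Matrix.isUnit_iff_isUnit_det _).1 hS),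
      spinorHom_one])

lemma bil_eq_dotProduct (A : SpinorMatrix) (i j : Fin 2) :
    bil A i j = dotProduct (xi i) ((A.map C) *ᵥ xi j) := by
  simp [bil, dotProduct, Matrix.mulVec, Finset.mul_sum, mul_left_comm, mul_assoc]

lemma bil_conj (S A : SpinorMatrix) (i j : Fin 2) :
    bil (S * A * Sᵀ) i j = spinorHom S (bil A i j) := by
  have h : ∀ i, spinorHom S ∘ xi i = (S.map C)ᵀ *ᵥ xi i := fun i => by
    ext1 α
    simp [spinorHom_xi, Matrix.mulVec, dotProduct]
  have h2 : (A.map C).map (spinorHom S) = A.map C := by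
    ext1 α β
    simp
  have h3 : spinorHom S (dotProduct (xi i) ((A.map C) *ᵥ xi j)) =
      dotProduct (spinorHom S ∘ xi i) ((A.map C).map (spinorHom S) *ᵥ (spinorHom S ∘ xi j)) := by
    simp [dotProduct, Matrix.mulVec]
  rw [bil_eq_dotProduct, bil_eq_dotProduct, h3, h, h, h2, Matrix.mulVec_transpose,
    ← Matrix.dotProduct_mulVec, Matrix.mulVec_mulVec, Matrix.mulVec_mulVec, Matrix.map_mul,
    Matrix.map_mul, Matrix.transpose_map, Matrix.mul_assoc]

/-- `S⁻¹ A S (Sᵀ C S)⁻¹ = S⁻¹ (A C⁻¹) (S⁻¹)ᵀ`, so an equivalent representation amounts to a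
substitution of the ghosts. -/
lemma spinorEquiv_bil (S : SpinorMatrix) (hS : IsUnit S) (A : SpinorMatrix) (i j : Fin 2) :
    spinorEquiv S hS (bil (A * stdC⁻¹) i j) =
      bil (S⁻¹ * A * S * (Sᵀ * stdC * S)⁻¹) i j := by
  change spinorHom S⁻¹ _ = _
  rw [← bil_conj]
  congr 1
  have h := (Matrix.isUnit_iff_isUnit_det _).1 hS
  rw [Matrix.mul_inv_rev, Matrix.mul_inv_rev, Matrix.transpose_nonsing_inv]
  simp only [← Matrix.mul_assoc]
  rw [Matrix.mul_assoc _ S S⁻¹, Matrix.mul_nonsing_inv _ h, Matrix.mul_one]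

/-! ### An isotropic frame -/

/-- The frame `e_k = ∑ frame k a • c^a` for Euclidean signature. -/
def frame : Matrix (Fin 5) (Fin 5) ℂ :=
  -- Null directions in the 3-4 plane and in the 1-2 plane, and `c^5`; they turn the Pauli factors
  -- into raising and lowering matrices.
  !![0, 0, -1 / 2, -Complex.I / 2, 0;
     0, 0, 1 / 2, -Complex.I / 2, 0;
     0, 0, 0, 0, 1;
     1 / 2, Complex.I / 2, 0, 0, 0;
     1 / 2, -Complex.I / 2, 0, 0, 0]

def frameInv : Matrix (Fin 5) (Fin 5) ℂ :=
  !![0, 0, 0, 1, 1;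
     0, 0, 0, -Complex.I, Complex.I;
     -1, 1, 0, 0, 0;
     Complex.I, Complex.I, 0, 0, 0;
     0, 0, 1, 0, 0]

lemma frame_mul_frameInv : frame * frameInv = 1 := by
  ext i j
  fin_cases i <;> fin_cases j <;>
    simp [frame, frameInv, Matrix.mul_apply, Fin.sum_univ_five] <;>
    ring_nf <;> simp <;> norm_num

def raise : Matrix (Fin 2) (Fin 2) ℂ := !![0, 1; 0, 0]
def lower : Matrix (Fin 2) (Fin 2) ℂ := !![0, 0; 1, 0]

/-- The gamma matrices with respect to the frame. -/
def frameGamma : Fin 5 → SpinorMatrix :=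
  ![(-2 • pauli3) ⊗ₖ lower, (2 • pauli3) ⊗ₖ raise, pauli3 ⊗ₖ pauli3,
    (2 • lower) ⊗ₖ pauli0, (2 • raise) ⊗ₖ pauli0]

lemma stdGamma_eq (t : ℕ) (a : Fin 5) :
    stdGamma t a = ∑ k, (kFactor t a * frame k a) • frameGamma k := by
  simp only [stdGamma, mul_smul, ← Finset.smul_sum]
  congr 1
  ext ⟨i, j⟩ ⟨k, l⟩
  fin_cases a <;> fin_cases i <;> fin_cases j <;> fin_cases k <;> fin_cases l <;>
    simp [frame, frameGamma, pauli0, pauli1, pauli2, pauli3, raise, lower, Fin.sum_univ_five,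
      Matrix.kroneckerMap_apply]

lemma gamma2_sum {A : Fin 5 → Fin 5 → ℂ} {γ Γ : Fin 5 → SpinorMatrix}
    (h : ∀ a, γ a = ∑ k, A k a • Γ k) (a b : Fin 5) :
    gamma2 γ a b = ∑ k, ∑ l, (A k a * A l b) • gamma2 Γ k l := by
  simp only [gamma2, h, Finset.sum_mul_sum, smul_mul_smul_comm, smul_sub, Finset.sum_sub_distrib,
    Finset.smul_sum]
  congr 1
  · refine Finset.sum_congr rfl fun k _ => Finset.sum_congr rfl fun l _ => ?_
    rw [smul_comm]
  · rw [Finset.sum_comm]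
    refine Finset.sum_congr rfl fun k _ => Finset.sum_congr rfl fun l _ => ?_
    rw [smul_comm, mul_comm (A l b)]

lemma stdC_inv : stdC⁻¹ = stdC := by
  apply Matrix.inv_eq_left_inv
  rw [stdC, ← Matrix.mul_kronecker_mul]
  have h1 : pauli1 * pauli1 = 1 := by
    ext i j; fin_cases i <;> fin_cases j <;> simp [pauli1]
  have h2 : pauli2 * pauli2 = 1 := by
    ext i j; fin_cases i <;> fin_cases j <;> simp [pauli2]
  rw [h1, h2, Matrix.one_kronecker_one]

/-- The gamma matrices with upper indices with respect to the frame. -/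
def frameGammaUp : Fin 5 → SpinorMatrix :=
  ![(-pauli3) ⊗ₖ raise, pauli3 ⊗ₖ lower, pauli3 ⊗ₖ pauli3, raise ⊗ₖ pauli0, lower ⊗ₖ pauli0]

lemma sum_frame_smul_stdGamma (k : Fin 5) :
    ∑ a, frame k a • stdGamma 0 a = frameGammaUp k := by
  ext ⟨i, j⟩ ⟨i', j'⟩
  simp only [stdGamma, kFactor, Nat.not_lt_zero, if_false, one_smul, Fin.sum_univ_five]
  fin_cases k <;> fin_cases i <;> fin_cases j <;> fin_cases i' <;> fin_cases j' <;>
    simp [frame, frameGammaUp, pauli0, pauli1, pauli2, pauli3, raise, lower,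
      Matrix.kroneckerMap_apply] <;> ring_nf <;> simp <;> norm_num

/-- The bilinears of the commutators of the gamma matrices in the frame. -/
def frameBil (k l : Fin 5) (i j : Fin 2) : XiPoly := bil (gamma2 frameGamma k l * stdC⁻¹) i j

lemma frameBil_swap (k l : Fin 5) (i j : Fin 2) : frameBil l k i j = -frameBil k l i j := by
  rw [frameBil, frameBil, ← bilₗ_apply, ← bilₗ_apply, ← map_neg, ← neg_mul]
  congr 2
  rw [gamma2, gamma2, ← smul_neg, neg_sub]

/-- The factor is written as `4i` times one half to fit the normalization of `sym`. -/
lemma frameBil_eq_of {k l : Fin 5} {K : SpinorMatrix}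
    (h : gamma2 frameGamma k l * stdC = (2 * Complex.I) • K) (i j : Fin 2) :
    frameBil k l i j = C (4 * Complex.I) * (C (1 / 2) * bil K i j) := by
  rw [frameBil, stdC_inv, h, ← bilₗ_apply, map_smul, MvPolynomial.smul_eq_C_mul, bilₗ_apply,
    ← mul_assoc, ← C_mul]
  congr 2
  ring

/-- Both `M` and `γ^k C⁻¹` are antisymmetric, so only minors of the two rows `ξ_1, ξ_2` appear. -/
lemma quad_eq (k : Fin 5) : C (-1 / 2 : ℂ) * ∑ i, ∑ j, C (pauli2 i j) *
    bil (frameGammaUp k * stdC⁻¹) i j = quad k := by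
  have half : (C (-1 / 2) : XiPoly) * 2 = -1 := by
    rw [show (2 : XiPoly) = C 2 from (map_ofNat C 2).symm, ← C_mul]; simp
  have hI : (C Complex.I : XiPoly) ^ 2 = -1 := by
    rw [← C_pow, Complex.I_sq]; simp
  rw [stdC_inv, stdC]
  fin_cases k <;>
    simp only [frameGammaUp, Fin.zero_eta, Fin.mk_one, Fin.reduceFinMk, Matrix.cons_val,
      ← Matrix.mul_kronecker_mul, quad, minor, bil, Fintype.sum_prod_type, Fin.sum_univ_two,
      Matrix.kroneckerMap_apply] <;>
    simp [pauli0, pauli1, pauli2, pauli3, raise, lower]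
  · linear_combination (xi 0 (0, 0) * xi 1 (1, 0) - xi 0 (1, 0) * xi 1 (0, 0)) * (C Complex.I ^ 2 * half - hI)
  · linear_combination (xi 0 (0, 1) * xi 1 (1, 1) - xi 0 (1, 1) * xi 1 (0, 1)) * (C Complex.I ^ 2 * half - hI)
  · linear_combination ((xi 0 (0, 0) * xi 1 (1, 1) - xi 0 (1, 1) * xi 1 (0, 0)) + (xi 0 (0, 1) * xi 1 (1, 0) - xi 0 (1, 0) * xi 1 (0, 1))) * (C Complex.I ^ 2 * half - hI)
  · linear_combination (xi 0 (0, 0) * xi 1 (0, 1) - xi 0 (0, 1) * xi 1 (0, 0)) * (C Complex.I ^ 2 * half - hI)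
  · linear_combination (xi 0 (1, 0) * xi 1 (1, 1) - xi 0 (1, 1) * xi 1 (1, 0)) * (C Complex.I ^ 2 * half - hI)

lemma frameBil_zero_one (i j : Fin 2) : frameBil 0 1 i j = C (4 * Complex.I) * -(sym (0, 0) (1, 1) i j + sym (0, 1) (1, 0) i j) := by
  rw [frameBil_eq_of (K := (-pauli1) ⊗ₖ pauli1)]
  · simp [bil, pauli1, sym, Fintype.sum_prod_type, Fin.sum_univ_two]
    ring
  · rw [gamma2, smul_mul_assoc, sub_mul, stdC]
    simp only [frameGamma, Matrix.cons_val, ← Matrix.mul_kronecker_mul]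
    ext ⟨i, j⟩ ⟨i', j'⟩
    fin_cases i <;> fin_cases j <;> fin_cases i' <;> fin_cases j' <;>
      simp [pauli0, pauli1, pauli2, pauli3, raise, lower, Matrix.kroneckerMap_apply]
    all_goals ring

lemma frameBil_zero_two (i j : Fin 2) : frameBil 0 2 i j = C (4 * Complex.I) * sym (0, 1) (1, 1) i j := by
  rw [frameBil_eq_of (K := pauli1 ⊗ₖ !![0, 0; 0, 1])]
  · simp [bil, pauli1, sym, Fintype.sum_prod_type, Fin.sum_univ_two]
    ring
  · rw [gamma2, smul_mul_assoc, sub_mul, stdC]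
    simp only [frameGamma, Matrix.cons_val, ← Matrix.mul_kronecker_mul]
    ext ⟨i, j⟩ ⟨i', j'⟩
    fin_cases i <;> fin_cases j <;> fin_cases i' <;> fin_cases j' <;>
      simp [pauli0, pauli1, pauli2, pauli3, raise, lower, Matrix.kroneckerMap_apply]
    all_goals ring

lemma frameBil_one_two (i j : Fin 2) : frameBil 1 2 i j = C (4 * Complex.I) * -sym (0, 0) (1, 0) i j := by
  rw [frameBil_eq_of (K := (-pauli1) ⊗ₖ !![1, 0; 0, 0])]
  · simp [bil, pauli1, sym, Fintype.sum_prod_type, Fin.sum_univ_two]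
    ring
  · rw [gamma2, smul_mul_assoc, sub_mul, stdC]
    simp only [frameGamma, Matrix.cons_val, ← Matrix.mul_kronecker_mul]
    ext ⟨i, j⟩ ⟨i', j'⟩
    fin_cases i <;> fin_cases j <;> fin_cases i' <;> fin_cases j' <;>
      simp [pauli0, pauli1, pauli2, pauli3, raise, lower, Matrix.kroneckerMap_apply]
    all_goals ring

lemma frameBil_zero_three (i j : Fin 2) : frameBil 0 3 i j = C (4 * Complex.I) * -sym (1, 1) (1, 1) i j := by
  rw [frameBil_eq_of (K := !![0, 0; 0, -2] ⊗ₖ !![0, 0; 0, 1])]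
  · simp [bil, sym, Fintype.sum_prod_type, Fin.sum_univ_two]
    rw [show (C 2 : XiPoly) = 2 from map_ofNat C 2]
    ring
  · rw [gamma2, smul_mul_assoc, sub_mul, stdC]
    simp only [frameGamma, Matrix.cons_val, ← Matrix.mul_kronecker_mul]
    ext ⟨i, j⟩ ⟨i', j'⟩
    fin_cases i <;> fin_cases j <;> fin_cases i' <;> fin_cases j' <;>
      simp [pauli0, pauli1, pauli2, pauli3, raise, lower, Matrix.kroneckerMap_apply]
    all_goals ring

lemma frameBil_one_three (i j : Fin 2) : frameBil 1 3 i j = C (4 * Complex.I) * -sym (1, 0) (1, 0) i j := by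
  rw [frameBil_eq_of (K := !![0, 0; 0, -2] ⊗ₖ !![1, 0; 0, 0])]
  · simp [bil, sym, Fintype.sum_prod_type, Fin.sum_univ_two]
    rw [show (C 2 : XiPoly) = 2 from map_ofNat C 2]
    ring
  · rw [gamma2, smul_mul_assoc, sub_mul, stdC]
    simp only [frameGamma, Matrix.cons_val, ← Matrix.mul_kronecker_mul]
    ext ⟨i, j⟩ ⟨i', j'⟩
    fin_cases i <;> fin_cases j <;> fin_cases i' <;> fin_cases j' <;>
      simp [pauli0, pauli1, pauli2, pauli3, raise, lower, Matrix.kroneckerMap_apply]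
    all_goals ring

lemma frameBil_two_three (i j : Fin 2) : frameBil 2 3 i j = C (4 * Complex.I) * sym (1, 0) (1, 1) i j := by
  rw [frameBil_eq_of (K := !![0, 0; 0, 1] ⊗ₖ pauli1)]
  · simp [bil, pauli1, sym, Fintype.sum_prod_type, Fin.sum_univ_two]
    ring
  · rw [gamma2, smul_mul_assoc, sub_mul, stdC]
    simp only [frameGamma, Matrix.cons_val, ← Matrix.mul_kronecker_mul]
    ext ⟨i, j⟩ ⟨i', j'⟩
    fin_cases i <;> fin_cases j <;> fin_cases i' <;> fin_cases j' <;>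
      simp [pauli0, pauli1, pauli2, pauli3, raise, lower, Matrix.kroneckerMap_apply]
    all_goals ring

lemma frameBil_zero_four (i j : Fin 2) : frameBil 0 4 i j = C (4 * Complex.I) * sym (0, 1) (0, 1) i j := by
  rw [frameBil_eq_of (K := !![2, 0; 0, 0] ⊗ₖ !![0, 0; 0, 1])]
  · simp [bil, sym, Fintype.sum_prod_type, Fin.sum_univ_two]
    rw [show (C 2 : XiPoly) = 2 from map_ofNat C 2]
    ring
  · rw [gamma2, smul_mul_assoc, sub_mul, stdC]
    simp only [frameGamma, Matrix.cons_val, ← Matrix.mul_kronecker_mul]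
    ext ⟨i, j⟩ ⟨i', j'⟩
    fin_cases i <;> fin_cases j <;> fin_cases i' <;> fin_cases j' <;>
      simp [pauli0, pauli1, pauli2, pauli3, raise, lower, Matrix.kroneckerMap_apply]
    all_goals ring

lemma frameBil_one_four (i j : Fin 2) : frameBil 1 4 i j = C (4 * Complex.I) * sym (0, 0) (0, 0) i j := by
  rw [frameBil_eq_of (K := !![2, 0; 0, 0] ⊗ₖ !![1, 0; 0, 0])]
  · simp [bil, sym, Fintype.sum_prod_type, Fin.sum_univ_two]
    rw [show (C 2 : XiPoly) = 2 from map_ofNat C 2]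
    ring
  · rw [gamma2, smul_mul_assoc, sub_mul, stdC]
    simp only [frameGamma, Matrix.cons_val, ← Matrix.mul_kronecker_mul]
    ext ⟨i, j⟩ ⟨i', j'⟩
    fin_cases i <;> fin_cases j <;> fin_cases i' <;> fin_cases j' <;>
      simp [pauli0, pauli1, pauli2, pauli3, raise, lower, Matrix.kroneckerMap_apply]
    all_goals ring

lemma frameBil_two_four (i j : Fin 2) : frameBil 2 4 i j = C (4 * Complex.I) * -sym (0, 0) (0, 1) i j := by
  rw [frameBil_eq_of (K := !![-1, 0; 0, 0] ⊗ₖ pauli1)]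
  · simp [bil, pauli1, sym, Fintype.sum_prod_type, Fin.sum_univ_two]
    ring
  · rw [gamma2, smul_mul_assoc, sub_mul, stdC]
    simp only [frameGamma, Matrix.cons_val, ← Matrix.mul_kronecker_mul]
    ext ⟨i, j⟩ ⟨i', j'⟩
    fin_cases i <;> fin_cases j <;> fin_cases i' <;> fin_cases j' <;>
      simp [pauli0, pauli1, pauli2, pauli3, raise, lower, Matrix.kroneckerMap_apply]
    all_goals ring

lemma frameBil_three_four (i j : Fin 2) : frameBil 3 4 i j = C (4 * Complex.I) * (sym (0, 0) (1, 1) i j - sym (0, 1) (1, 0) i j) := by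
  rw [frameBil_eq_of (K := !![0, 1; -1, 0] ⊗ₖ !![0, 1; -1, 0])]
  · simp [bil, pauli1, sym, Fintype.sum_prod_type, Fin.sum_univ_two]
    ring
  · rw [gamma2, smul_mul_assoc, sub_mul, stdC]
    simp only [frameGamma, Matrix.cons_val, ← Matrix.mul_kronecker_mul]
    ext ⟨i, j⟩ ⟨i', j'⟩
    fin_cases i <;> fin_cases j <;> fin_cases i' <;> fin_cases j' <;>
      simp [pauli0, pauli1, pauli2, pauli3, raise, lower, Matrix.kroneckerMap_apply]
    all_goals ring

lemma frameBil_self (k : Fin 5) (i j : Fin 2) : frameBil k k i j = 0 := by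
  simp [frameBil, gamma2, bil]

/-- The cocycle condition behind all nontrivial representatives. -/
lemma sum_quad_mul_frameBil (l : Fin 5) (i j : Fin 2) : ∑ k, quad k * frameBil k l i j = 0 := by
  rw [Fin.sum_univ_five]
  fin_cases l <;>
    simp only [Fin.zero_eta, Fin.mk_one, Fin.reduceFinMk, frameBil_self, frameBil_swap 0 1,
      frameBil_swap 0 2, frameBil_swap 1 2, frameBil_swap 0 3, frameBil_swap 1 3,
      frameBil_swap 2 3, frameBil_swap 0 4, frameBil_swap 1 4, frameBil_swap 2 4,
      frameBil_swap 3 4, frameBil_zero_one, frameBil_zero_two, frameBil_one_two,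
      frameBil_zero_three, frameBil_one_three, frameBil_two_three, frameBil_zero_four,
      frameBil_one_four, frameBil_two_four, frameBil_three_four, sym, quad, Matrix.cons_val,
      minor] <;>
    fin_cases i <;> fin_cases j <;>
    simp only [Fin.zero_eta, Fin.mk_one] <;> ring

/-! ### The Koszul complex with respect to the frame -/

/-- The frame matrix for signature `(t, 5 - t)`. -/
def frameOf (t : ℕ) : Matrix (Fin 5) (Fin 5) ℂ := fun k a => kFactor t a * frame k a

def frameOfInv (t : ℕ) : Matrix (Fin 5) (Fin 5) ℂ := fun a k => (kFactor t a)⁻¹ * frameInv a k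

lemma kFactor_ne_zero (t : ℕ) (a : Fin 5) : kFactor t a ≠ 0 := by
  unfold kFactor
  split_ifs <;> simp

lemma frameOf_mul_inv (t : ℕ) : frameOf t * frameOfInv t = 1 := by
  rw [← frame_mul_frameInv]
  ext k l
  simp only [Matrix.mul_apply, frameOf, frameOfInv]
  refine Finset.sum_congr rfl fun a _ => ?_
  have := kFactor_ne_zero t a
  field_simp

lemma frameOf_inv_mul (t : ℕ) : frameOfInv t * frameOf t = 1 :=
  mul_eq_one_comm.1 (frameOf_mul_inv t)

/-- The frame `e_k`. -/
def frameVec (t : ℕ) (k : Fin 5) : Fin 5 → XiPoly := fun a => C (frameOf t k a)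

/-- The dual frame. -/
def frameDual (t : ℕ) (k : Fin 5) : Module.Dual XiPoly (Fin 5 → XiPoly) :=
  ∑ a, (C (frameOfInv t a k) : XiPoly) •
    (LinearMap.proj a : (Fin 5 → XiPoly) →ₗ[XiPoly] XiPoly)

lemma frameDual_frameVec (t : ℕ) (k l : Fin 5) :
    frameDual t k (frameVec t l) = if k = l then 1 else 0 := by
  have := congrFun (congrFun (frameOf_mul_inv t) l) k
  rw [Matrix.mul_apply, Matrix.one_apply] at this
  simp only [frameDual, frameVec, LinearMap.sum_apply, LinearMap.smul_apply, LinearMap.proj_apply,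
    smul_eq_mul, ← C_mul, ← map_sum]
  simp_rw [mul_comm (frameOfInv t _ k), this, eq_comm (a := k)]
  split_ifs <;> simp

lemma single_eq_sum_frameVec (t : ℕ) (a : Fin 5) :
    (Pi.single a 1 : Fin 5 → XiPoly) = ∑ k, (C (frameOfInv t a k) : XiPoly) • frameVec t k := by
  ext1 b
  have := congrFun (congrFun (frameOf_inv_mul t) a) b
  rw [Matrix.mul_apply, Matrix.one_apply] at this
  simp only [Finset.sum_apply, Pi.smul_apply, frameVec, smul_eq_mul, ← C_mul, ← map_sum, this,
    Pi.single_apply, eq_comm (a := b)]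
  split_ifs <;> simp

lemma span_frameVec (t : ℕ) : Submodule.span XiPoly (Set.range (frameVec t)) = ⊤ := by
  rw [eq_top_iff, ← (Pi.basisFun XiPoly (Fin 5)).span_eq, Submodule.span_le]
  rintro _ ⟨a, rfl⟩
  rw [Pi.basisFun_apply, single_eq_sum_frameVec t]
  exact Submodule.sum_mem _ fun k _ => Submodule.smul_mem _ _ (Submodule.subset_span ⟨k, rfl⟩)

/-- The functional `c^a ↦ fb c^a`. -/
def fbDual (t : ℕ) (γ : Fin 5 → SpinorMatrix) (Ch : SpinorMatrix) :
    Module.Dual XiPoly (Fin 5 → XiPoly) :=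
  ∑ a, (C (-1 / 2 : ℂ) * ∑ i, ∑ j, C (pauli2 i j) * bil (gammaUp t γ a * Ch⁻¹) i j) •
    LinearMap.proj a

lemma fb_eq_contract (t : ℕ) (γ : Fin 5 → SpinorMatrix) (Ch : SpinorMatrix) :
    fb t γ Ch = contract (fbDual t γ Ch) := by
  simp only [fb, fbDual, contract, map_sum, map_smul]
  rfl

section Rep

variable {t : ℕ} {γ : Fin 5 → SpinorMatrix} {Ch S : SpinorMatrix}

lemma bil_gammaUp (hS : IsUnit S) (hγ : ∀ a, γ a = S⁻¹ * stdGamma t a * S)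
    (hC : Ch = Sᵀ * stdC * S) (a : Fin 5) (i j : Fin 2) :
    bil (gammaUp t γ a * Ch⁻¹) i j =
      C (etaDiag t a * kFactor t a) *
        spinorEquiv S hS (bil (stdGamma 0 a * stdC⁻¹) i j) := by
  have h1 : stdGamma t a = kFactor t a • stdGamma 0 a := by simp [stdGamma, kFactor]
  rw [spinorEquiv_bil, gammaUp, hγ, hC, h1, ← MvPolynomial.smul_eq_C_mul, ← bilₗ_apply,
    ← bilₗ_apply, ← map_smul]
  simp [mul_smul]

/-- Lower-index gamma matrices expand in the frame with the same coefficients by which the `e_k`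
expand in the `c^a`. -/
lemma bil_gamma2 (hS : IsUnit S) (hγ : ∀ a, γ a = S⁻¹ * stdGamma t a * S)
    (hC : Ch = Sᵀ * stdC * S) (a b : Fin 5) (i j : Fin 2) :
    bil (gamma2 γ a b * Ch⁻¹) i j =
      ∑ k, ∑ l, C (frameOf t k a * frameOf t l b) * spinorEquiv S hS (frameBil k l i j) := by
  have h : ∀ a, γ a = ∑ k, frameOf t k a • (S⁻¹ * frameGamma k * S) := fun a => by
    rw [hγ, stdGamma_eq, Finset.mul_sum, Finset.sum_mul]
    simp [frameOf]
  have h2 : ∀ k l, gamma2 (fun k => S⁻¹ * frameGamma k * S) k l =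
      S⁻¹ * gamma2 frameGamma k l * S := fun k l => by
    have hu := Matrix.mul_nonsing_inv S ((Matrix.isUnit_iff_isUnit_det _).1 hS)
    have : ∀ A B : SpinorMatrix, S⁻¹ * A * S * (S⁻¹ * B * S) = S⁻¹ * (A * B) * S := fun A B => by
      rw [show S⁻¹ * A * S * (S⁻¹ * B * S) = S⁻¹ * A * (S * S⁻¹) * B * S by
        simp only [Matrix.mul_assoc], hu]
      simp only [Matrix.mul_assoc, Matrix.one_mul]
    simp only [gamma2, this, mul_smul_comm, smul_mul_assoc, mul_sub, sub_mul]
  rw [gamma2_sum h, ← bilₗ_apply]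
  simp only [Finset.sum_mul, smul_mul_assoc, map_sum, map_smul, h2, hC, frameBil, spinorEquiv_bil,
    MvPolynomial.smul_eq_C_mul, bilₗ_apply]

/-- The signature drops out because `η_a k_a² = 1`: one `k_a` comes from `γ^a`, the other from the
rescaled frame. -/
lemma fbDual_frameVec (hS : IsUnit S) (hγ : ∀ a, γ a = S⁻¹ * stdGamma t a * S)
    (hC : Ch = Sᵀ * stdC * S) (k : Fin 5) :
    fbDual t γ Ch (frameVec t k) = spinorEquiv S hS (quad k) := by
  have hk : ∀ a, etaDiag t a * kFactor t a * frameOf t k a = frame k a := fun a => by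
    rw [frameOf, ← mul_assoc, mul_assoc (etaDiag t a)]
    unfold etaDiag kFactor
    split_ifs <;> simp
  rw [← quad_eq, ← sum_frame_smul_stdGamma]
  simp only [fbDual, LinearMap.sum_apply, LinearMap.smul_apply, LinearMap.proj_apply, smul_eq_mul,
    frameVec, bil_gammaUp hS hγ hC]
  have hlin : ∀ i j, bil ((∑ a, frame k a • stdGamma 0 a) * stdC⁻¹) i j =
      ∑ a, C (etaDiag t a * kFactor t a * frameOf t k a) * bil (stdGamma 0 a * stdC⁻¹) i j := by
    intro i j
    rw [← bilₗ_apply]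
    simp only [Finset.sum_mul, smul_mul_assoc, map_sum, map_smul, hk, bilₗ_apply,
      MvPolynomial.smul_eq_C_mul]
  have hψ : ∀ c, spinorEquiv S hS (C c) = C c := fun c => (spinorEquiv S hS).commutes c
  simp only [hlin]
  simp only [map_sum, map_mul, hψ, Fin.sum_univ_two, Fin.sum_univ_five, map_add]
  ring

end Rep

/-! ### Representatives -/

/-- The general representatives form a submodule. -/
def repSubmodule (γ : Fin 5 → SpinorMatrix) (Ch : SpinorMatrix) : Submodule XiPoly GhostPoly where
  carrier := {ω | ∃ P P11 P12 P22 Q11 Q12 Q22, ω = representative γ Ch P P11 P12 P22 Q11 Q12 Q22}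
  zero_mem' := ⟨0, 0, 0, 0, 0, 0, 0, by simp [representative]⟩
  add_mem' := by
    rintro _ _ ⟨P, P11, P12, P22, Q11, Q12, Q22, rfl⟩ ⟨P', P11', P12', P22', Q11', Q12', Q22', rfl⟩
    refine ⟨P + P', P11 + P11', P12 + P12', P22 + P22', Q11 + Q11', Q12 + Q12', Q22 + Q22', ?_⟩
    simp only [representative, map_add, add_smul, Pi.add_apply, Finset.sum_add_distrib]
    abel
  smul_mem' := by
    rintro r _ ⟨P, P11, P12, P22, Q11, Q12, Q22, rfl⟩
    refine ⟨r * P, r * P11, r * P12, r * P22, r • Q11, r • Q12, r • Q22, ?_⟩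
    simp only [representative, mul_smul, Pi.smul_apply, smul_eq_mul, smul_add,
      Finset.smul_sum, Algebra.algebraMap_eq_smul_one]

/-- The index pairs `(1, 1), (1, 2), (2, 2)`. -/
def pairs : Fin 3 → Fin 2 × Fin 2 := ![(0, 0), (0, 1), (1, 1)]

lemma algebraMap_mem_repSubmodule (γ : Fin 5 → SpinorMatrix) (Ch : SpinorMatrix) (x : XiPoly) :
    algebraMap XiPoly GhostPoly x ∈ repSubmodule γ Ch :=
  ⟨x, 0, 0, 0, 0, 0, 0, by simp [representative]⟩

lemma theta_mem_repSubmodule (γ : Fin 5 → SpinorMatrix) (Ch : SpinorMatrix) (n : Fin 3) :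
    theta γ Ch (pairs n).1 (pairs n).2 ∈ repSubmodule γ Ch := by
  fin_cases n
  · exact ⟨0, 1, 0, 0, 0, 0, 0, by simp [representative, pairs]⟩
  · exact ⟨0, 0, 1, 0, 0, 0, 0, by simp [representative, pairs]⟩
  · exact ⟨0, 0, 0, 1, 0, 0, 0, by simp [representative, pairs]⟩

lemma thetaVec_mem_repSubmodule (γ : Fin 5 → SpinorMatrix) (Ch : SpinorMatrix) (a : Fin 5)
    (n : Fin 3) : thetaVec γ Ch a (pairs n).1 (pairs n).2 ∈ repSubmodule γ Ch := by
  fin_cases n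
  · exact ⟨0, 0, 0, 0, Pi.single a 1, 0, 0, by
      simp [representative, pairs, Pi.single_apply, ite_smul]⟩
  · exact ⟨0, 0, 0, 0, 0, Pi.single a 1, 0, by
      simp [representative, pairs, Pi.single_apply, ite_smul]⟩
  · exact ⟨0, 0, 0, 0, 0, 0, Pi.single a 1, by
      simp [representative, pairs, Pi.single_apply, ite_smul]⟩

lemma c_mem (a : Fin 5) : c a ∈ ⋀[XiPoly]^1 (Fin 5 → XiPoly) := by
  rw [ExteriorAlgebra.exteriorPower, pow_one]
  exact ⟨_, rfl⟩

lemma theta_mem (γ : Fin 5 → SpinorMatrix) (Ch : SpinorMatrix) (i j : Fin 2) :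
    theta γ Ch i j ∈ ⋀[XiPoly]^2 (Fin 5 → XiPoly) := by
  refine Submodule.sum_mem _ fun a _ => Submodule.sum_mem _ fun b _ => Submodule.smul_mem _ _ ?_
  exact SetLike.mul_mem_graded (A := fun i : ℕ ↦ ⋀[XiPoly]^i (Fin 5 → XiPoly)) (c_mem a) (c_mem b)

lemma thetaVec_mem (γ : Fin 5 → SpinorMatrix) (Ch : SpinorMatrix) (a : Fin 5) (i j : Fin 2) :
    thetaVec γ Ch a i j ∈ ⋀[XiPoly]^1 (Fin 5 → XiPoly) :=
  Submodule.sum_mem _ fun b _ => Submodule.smul_mem _ _ (c_mem b)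

lemma proj_eq_zero_of_mem_repSubmodule {γ : Fin 5 → SpinorMatrix} {Ch : SpinorMatrix} {p : ℕ}
    (hp : 2 < p) {ρ : GhostPoly} (hρ : ρ ∈ repSubmodule γ Ch) :
    GradedRing.proj (fun i : ℕ ↦ ⋀[XiPoly]^i (Fin 5 → XiPoly)) p ρ = 0 := by
  have h : ∀ q < p, ∀ x ∈ ⋀[XiPoly]^q (Fin 5 → XiPoly),
      GradedRing.proj (fun i : ℕ ↦ ⋀[XiPoly]^i (Fin 5 → XiPoly)) p x = 0 := fun q hq x hx => by
    rw [GradedRing.proj_apply,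
      DirectSum.decompose_of_mem_ne (fun i : ℕ ↦ ⋀[XiPoly]^i (Fin 5 → XiPoly)) hx hq.ne]
  have h0 : ∀ x : XiPoly, algebraMap XiPoly GhostPoly x ∈ ⋀[XiPoly]^0 (Fin 5 → XiPoly) := by
    intro x
    rw [ExteriorAlgebra.exteriorPower, pow_zero, Submodule.mem_one]
    exact ⟨x, rfl⟩
  obtain ⟨P, P11, P12, P22, Q11, Q12, Q22, rfl⟩ := hρ
  simp only [representative, map_add, map_sum,
    h 0 (by omega) _ (h0 P), fun (r : XiPoly) i j =>
      h 2 hp _ (Submodule.smul_mem _ r (theta_mem γ Ch i j)), fun (r : XiPoly) a i j =>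
      h 1 (by omega) _ (Submodule.smul_mem _ r (thetaVec_mem γ Ch a i j)), add_zero,
    Finset.sum_const_zero]

section Rep

variable {t : ℕ} {γ : Fin 5 → SpinorMatrix} {Ch S : SpinorMatrix}

lemma ι_frameVec (t : ℕ) (k : Fin 5) :
    ExteriorAlgebra.ι XiPoly (frameVec t k) = ∑ a, (C (frameOf t k a) : XiPoly) • c a := by
  have : frameVec t k = ∑ a, (C (frameOf t k a) : XiPoly) • (Pi.single a 1 : Fin 5 → XiPoly) := by
    ext1 b
    simp [frameVec, Pi.single_apply]
  rw [this, map_sum]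
  simp [c]

/-- `thetaVec` with the vector index referring to the frame. -/
def frameTheta (t : ℕ) (ψ : XiPoly ≃ₐ[ℂ] XiPoly) (l : Fin 5) (i j : Fin 2) : GhostPoly :=
  ∑ k, ψ (frameBil k l i j) • ExteriorAlgebra.ι XiPoly (frameVec t k)

lemma thetaVec_eq (hS : IsUnit S) (hγ : ∀ a, γ a = S⁻¹ * stdGamma t a * S)
    (hC : Ch = Sᵀ * stdC * S) (a : Fin 5) (i j : Fin 2) :
    thetaVec γ Ch a i j =
      ∑ l, (C (frameOf t l a) : XiPoly) • frameTheta t (spinorEquiv S hS) l i j := by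
  simp only [thetaVec, bil_gamma2 hS hγ hC, frameTheta, ι_frameVec, Finset.sum_smul,
    Finset.smul_sum, smul_smul]
  rw [Finset.sum_comm]
  conv_rhs => rw [Finset.sum_comm]
  refine Finset.sum_congr rfl fun k _ => ?_
  rw [Finset.sum_comm]
  refine Finset.sum_congr rfl fun l _ => Finset.sum_congr rfl fun b _ => ?_
  rw [C_mul]
  congr 1
  ring

lemma theta_eq (hS : IsUnit S) (hγ : ∀ a, γ a = S⁻¹ * stdGamma t a * S)
    (hC : Ch = Sᵀ * stdC * S) (i j : Fin 2) :
    theta γ Ch i j = ∑ k, ∑ l, spinorEquiv S hS (frameBil k l i j) •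
      (ExteriorAlgebra.ι XiPoly (frameVec t k) * ExteriorAlgebra.ι XiPoly (frameVec t l)) := by
  simp only [theta, bil_gamma2 hS hγ hC, ι_frameVec, Finset.sum_mul_sum, Finset.sum_smul,
    Finset.smul_sum, smul_mul_smul_comm, smul_smul]
  rw [Finset.sum_congr rfl fun a _ => Finset.sum_comm, Finset.sum_comm]
  refine Finset.sum_congr rfl fun k _ => ?_
  rw [Finset.sum_congr rfl fun a _ => Finset.sum_comm, Finset.sum_comm]
  refine Finset.sum_congr rfl fun l _ => Finset.sum_congr rfl fun a _ =>
    Finset.sum_congr rfl fun b _ => ?_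
  rw [C_mul]
  congr 1
  ring

lemma frameTheta_mem_repSubmodule (hS : IsUnit S) (hγ : ∀ a, γ a = S⁻¹ * stdGamma t a * S)
    (hC : Ch = Sᵀ * stdC * S) (l : Fin 5) (n : Fin 3) :
    frameTheta t (spinorEquiv S hS) l (pairs n).1 (pairs n).2 ∈ repSubmodule γ Ch := by
  have : frameTheta t (spinorEquiv S hS) l (pairs n).1 (pairs n).2 =
      ∑ a, (C (frameOfInv t a l) : XiPoly) • thetaVec γ Ch a (pairs n).1 (pairs n).2 := by
    simp only [thetaVec_eq hS hγ hC, Finset.smul_sum, smul_smul]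
    rw [Finset.sum_comm]
    simp only [← Finset.sum_smul, ← C_mul, ← map_sum]
    have h : ∀ k, ∑ a, frameOfInv t a l * frameOf t k a = if k = l then 1 else 0 := fun k => by
      rw [← Matrix.one_apply, ← frameOf_mul_inv t, Matrix.mul_apply]
      simp only [mul_comm]
    simp [h, apply_ite C, ite_smul]
  rw [this]
  exact Submodule.sum_mem _ fun a _ =>
    Submodule.smul_mem _ _ (thetaVec_mem_repSubmodule γ Ch a n)

lemma fb_frameTheta (hS : IsUnit S) (hγ : ∀ a, γ a = S⁻¹ * stdGamma t a * S)
    (hC : Ch = Sᵀ * stdC * S) (l : Fin 5) (i j : Fin 2) :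
    fb t γ Ch (frameTheta t (spinorEquiv S hS) l i j) = 0 := by
  have := congrArg (spinorEquiv S hS) (sum_quad_mul_frameBil l i j)
  rw [map_zero, map_sum] at this
  simp only [map_mul] at this
  have hι : ∀ k, contract (fbDual t γ Ch) (ExteriorAlgebra.ι XiPoly (frameVec t k)) =
      algebraMap XiPoly GhostPoly (spinorEquiv S hS (quad k)) := fun k => by
    rw [← fbDual_frameVec hS hγ hC]
    exact CliffordAlgebra.contractLeft_ι (Q := 0) _ _
  rw [fb_eq_contract, frameTheta, map_sum]
  simp only [map_smul, hι]
  simp only [Algebra.smul_def, ← map_mul, ← map_sum]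
  rw [← map_zero (algebraMap XiPoly GhostPoly), ← this]
  simp only [mul_comm, map_sum, map_mul]

lemma fb_theta (hS : IsUnit S) (hγ : ∀ a, γ a = S⁻¹ * stdGamma t a * S)
    (hC : Ch = Sᵀ * stdC * S) (i j : Fin 2) : fb t γ Ch (theta γ Ch i j) = 0 := by
  have h := fun l => congrArg (spinorEquiv S hS) (sum_quad_mul_frameBil l i j)
  simp only [map_zero, map_sum, map_mul] at h
  have hι : ∀ k, contract (fbDual t γ Ch) (ExteriorAlgebra.ι XiPoly (frameVec t k)) =
      algebraMap XiPoly GhostPoly (spinorEquiv S hS (quad k)) := fun k => by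
    rw [← fbDual_frameVec hS hγ hC]
    exact CliffordAlgebra.contractLeft_ι (Q := 0) _ _
  rw [fb_eq_contract, theta_eq hS hγ hC]
  simp only [map_sum, map_smul, contract_ι_mul, hι, fbDual_frameVec hS hγ hC, smul_sub, smul_smul,
    Finset.sum_sub_distrib, ← Algebra.commutes, ← Algebra.smul_def]
  have h1 : ∀ l, ∑ k, (spinorEquiv S hS (frameBil k l i j) * spinorEquiv S hS (quad k)) = 0 :=
    fun l => by rw [← h l]; simp only [mul_comm]
  have h2 : ∀ k, ∑ l, (spinorEquiv S hS (frameBil k l i j) * spinorEquiv S hS (quad l)) = 0 :=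
    fun k => by
      rw [← neg_zero, ← h1 k, ← Finset.sum_neg_distrib]
      simp only [frameBil_swap k, map_neg, neg_mul, neg_neg]
  rw [Finset.sum_comm]
  simp only [← Finset.sum_smul, h1, h2, zero_smul, Finset.sum_const_zero, sub_self]

lemma fb_eq_zero_of_mem_repSubmodule (hS : IsUnit S) (hγ : ∀ a, γ a = S⁻¹ * stdGamma t a * S)
    (hC : Ch = Sᵀ * stdC * S) {ρ : GhostPoly} (hρ : ρ ∈ repSubmodule γ Ch) :
    fb t γ Ch ρ = 0 := by
  have hv : ∀ a i j, fb t γ Ch (thetaVec γ Ch a i j) = 0 := fun a i j => by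
    simp [thetaVec_eq hS hγ hC, map_sum, fb_frameTheta hS hγ hC]
  have h0 : ∀ P, fb t γ Ch (algebraMap XiPoly GhostPoly P) = 0 := fun P => by
    rw [fb_eq_contract]
    exact CliffordAlgebra.contractLeft_algebraMap (Q := 0) _ _
  obtain ⟨P, P11, P12, P22, Q11, Q12, Q22, rfl⟩ := hρ
  simp [representative, hv, h0, fb_theta hS hγ hC]

lemma fb_fb (t : ℕ) (γ : Fin 5 → SpinorMatrix) (Ch : SpinorMatrix) (ω : GhostPoly) :
    fb t γ Ch (fb t γ Ch ω) = 0 := by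
  rw [fb_eq_contract]
  exact CliffordAlgebra.contractLeft_contractLeft (Q := 0) _ _

end Rep

/-! ### The model of the complex -/

/-- The part generated by `e₀, e₁, e₂`. -/
def model3 (t : ℕ) : Kosz3 →ₗ[XiPoly] GhostPoly :=
  adjoinι (adjoinι (adjoinι (Algebra.linearMap XiPoly (ExteriorAlgebra XiPoly (Fin 5 → XiPoly)))
    (frameVec t 0)) (frameVec t 1)) (frameVec t 2)

def model5 (t : ℕ) : (Kosz3 × Kosz3) × (Kosz3 × Kosz3) →ₗ[XiPoly] GhostPoly :=
  adjoinι (adjoinι (model3 t) (frameVec t 3)) (frameVec t 4)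

section Rep

variable {t : ℕ} {γ : Fin 5 → SpinorMatrix} {Ch S : SpinorMatrix}

lemma isKoszulModel_model5 (hS : IsUnit S) (hγ : ∀ a, γ a = S⁻¹ * stdGamma t a * S)
    (hC : Ch = Sᵀ * stdC * S) :
    IsKoszulModel (fbDual t γ Ch) (frameVec t) (frameDual t) ∅
      (cone (cone (kosz3 (spinorEquiv S hS)) (spinorEquiv S hS (quad 3)))
        (spinorEquiv S hS (quad 4))) (model5 t) := by
  have d1 : ∀ k, frameDual t k (frameVec t k) = 1 := fun k => by simp [frameDual_frameVec]
  have d2 : ∀ k l, k ≠ l → frameDual t k (frameVec t l) = 0 := fun k l h => by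
    simp [frameDual_frameVec, h]
  have hq := fbDual_frameVec (t := t) hS hγ hC
  have h := ((((((isKoszulModel_base (fbDual t γ Ch) (frameVec t) (frameDual t)).adjoin d1 d2
    (k := 0) (by simp) (hq 0)).adjoin d1 d2 (k := 1) (by simp) (hq 1)).adjoin d1 d2
    (k := 2) (by simp) (hq 2)).adjoin d1 d2 (k := 3) (by simp) (hq 3)).adjoin d1 d2
    (k := 4) (by simp) (hq 4))
  convert h using 1
  · ext k
    fin_cases k <;> simp
  · rfl
  · rfl

/-- `ρ` has the part `α` free of `e₃` and `e₄`. -/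
def HasPart (t : ℕ) (ρ : GhostPoly) (α : Kosz3) : Prop := ∃ m, model5 t m = ρ ∧ m.1.1 = α

set_option synthInstance.maxSize 1000 in
lemma HasPart.add {ρ ρ' : GhostPoly} {α α' : Kosz3} (h : HasPart t ρ α) (h' : HasPart t ρ' α') :
    HasPart t (ρ + ρ') (α + α') := by
  obtain ⟨m, rfl, rfl⟩ := h
  obtain ⟨m', rfl, rfl⟩ := h'
  exact ⟨m + m', map_add _ _ _, rfl⟩

lemma HasPart.smul (r : XiPoly) {ρ : GhostPoly} {α : Kosz3} (h : HasPart t ρ α) :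
    HasPart t (r • ρ) (r • α) := by
  obtain ⟨m, rfl, rfl⟩ := h
  exact ⟨r • m, map_smul _ _ _, rfl⟩

lemma HasPart.sum {ρ : Fin 3 → GhostPoly} {α : Fin 3 → Kosz3} (h : ∀ n, HasPart t (ρ n) (α n)) :
    HasPart t (∑ n, ρ n) (∑ n, α n) := by
  choose m hm hm' using h
  refine ⟨∑ n, m n, by simp [map_sum, hm], ?_⟩
  simp [Prod.fst_sum, hm']

lemma hasPart_algebraMap (x : XiPoly) :
    HasPart t (algebraMap XiPoly GhostPoly x) (((x, 0), 0), 0) :=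
  ⟨(((((x, 0), 0), 0), 0), 0), by simp [model5, model3], rfl⟩

lemma hasPart_frameTheta (ψ : XiPoly ≃ₐ[ℂ] XiPoly) (l : Fin 5) (i j : Fin 2) :
    HasPart t (frameTheta t ψ l i j) (((0, ψ (frameBil 0 l i j)), (ψ (frameBil 1 l i j), 0)),
      ((ψ (frameBil 2 l i j), 0), 0)) := by
  refine ⟨((_, (((ψ (frameBil 3 l i j), 0), 0), 0)), ((((ψ (frameBil 4 l i j), 0), 0), 0), 0)),
    ?_, rfl⟩
  simp only [model5, model3, adjoinι_apply, frameTheta, Fin.sum_univ_five, Prod.fst_zero,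
    Prod.snd_zero, map_zero, mul_zero, zero_add, add_zero, Algebra.linearMap_apply,
    Algebra.smul_def, Algebra.commutes]

/-- `frameBil k l` and `e_k e_l` are both antisymmetric in `k, l`, so the two orders contribute
equally; hence the factor `2`. -/
lemma hasPart_theta (hS : IsUnit S) (hγ : ∀ a, γ a = S⁻¹ * stdGamma t a * S)
    (hC : Ch = Sᵀ * stdC * S) (i j : Fin 2) :
    HasPart t (theta γ Ch i j) ((2 : XiPoly) •
      (((0, 0), (0, spinorEquiv S hS (frameBil 1 0 i j))),
        ((0, spinorEquiv S hS (frameBil 2 0 i j)), (spinorEquiv S hS (frameBil 2 1 i j), 0)))) := by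
  have hθ := theta_eq hS hγ hC i j
  set ψ := spinorEquiv S hS
  refine ⟨(2 : XiPoly) • ((_,
    (((0, ψ (frameBil 3 0 i j)), (ψ (frameBil 3 1 i j), 0)), ((ψ (frameBil 3 2 i j), 0), 0))),
    ((((0, ψ (frameBil 4 0 i j)), (ψ (frameBil 4 1 i j), 0)), ((ψ (frameBil 4 2 i j), 0), 0)),
      (((ψ (frameBil 4 3 i j), 0), 0), 0))), ?_, rfl⟩
  have hsq : ∀ k, ExteriorAlgebra.ι XiPoly (frameVec t k) * ExteriorAlgebra.ι XiPoly (frameVec t k)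
      = 0 := fun k => ExteriorAlgebra.ι_sq_zero _
  have hsw : ∀ k l, ExteriorAlgebra.ι XiPoly (frameVec t k) *
      ExteriorAlgebra.ι XiPoly (frameVec t l) = -(ExteriorAlgebra.ι XiPoly (frameVec t l) *
      ExteriorAlgebra.ι XiPoly (frameVec t k)) := fun k l =>
    eq_neg_of_add_eq_zero_left (ExteriorAlgebra.ι_add_mul_swap _ _)
  have hc : ∀ k l, ψ (frameBil k l i j) • (ExteriorAlgebra.ι XiPoly (frameVec t k) *
      ExteriorAlgebra.ι XiPoly (frameVec t l)) = ψ (frameBil l k i j) •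
      (ExteriorAlgebra.ι XiPoly (frameVec t l) * ExteriorAlgebra.ι XiPoly (frameVec t k)) :=
    fun k l => by rw [hsw k l, frameBil_swap l k, map_neg, neg_smul, smul_neg, neg_neg]
  rw [map_smul, hθ]
  simp only [Fin.sum_univ_five, hsq, hc 0 1, hc 0 2, hc 1 2, hc 0 3, hc 1 3, hc 2 3, hc 0 4,
    hc 1 4, hc 2 4, hc 3 4]
  simp only [model5, model3, adjoinι_apply, Prod.fst_zero,
    Prod.snd_zero, map_zero, mul_zero, zero_add, add_zero, Algebra.linearMap_apply,
    mul_add, ← Algebra.commutes, ← Algebra.smul_def, mul_smul_comm, smul_zero]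
  module

/-- The components of `frameTheta` on `e_0, e_1, e_2` reproduce, up to scale, one syzygy family for
each frame index, and `theta` gives the family of degree two. -/
lemma exists_hasPart (hS : IsUnit S) (hγ : ∀ a, γ a = S⁻¹ * stdGamma t a * S)
    (hC : Ch = Sᵀ * stdC * S) (x : XiPoly) (l₁ l₂ m₁ m₂ m₃ n : Fin 3 → XiPoly) :
    ∃ ρ ∈ repSubmodule γ Ch, HasPart t ρ
      ((((x, 0), 0), 0) + cocycle3 (spinorEquiv S hS) l₁ l₂ m₁ m₂ m₃ n) := by
  have hθ := hasPart_theta hS hγ hC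
  have hT := frameTheta_mem_repSubmodule hS hγ hC
  set ψ := spinorEquiv S hS
  -- Removes the common factor `4i` of all `frameBil`; for `theta` a further one half cancels the
  -- factor `2`.
  set κ : XiPoly := C (4 * Complex.I)⁻¹
  have hκ : κ * ψ (C (4 * Complex.I)) = 1 := by
    rw [show ψ (C (4 * Complex.I)) = C (4 * Complex.I) from ψ.commutes _, ← C_mul,
      inv_mul_cancel₀ (by simp), C_1]
  have hhalf := C_half_mul_two (σ := Fin 2 × SpinorIdx)
  rw [C_mul, map_mul] at hκ
  have hG : ∀ r s, κ * r * (ψ (C 4) * ψ (C Complex.I) * s) = r * s := fun r s => by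
    linear_combination (r * s) * hκ
  have hG' : ∀ r s, C (1 / 2) * κ * r * (2 * (ψ (C 4) * ψ (C Complex.I) * s)) = r * s :=
    fun r s => by
      linear_combination (r * s) * hκ + κ * (ψ (C 4) * ψ (C Complex.I)) * r * s * hhalf
  refine ⟨algebraMap XiPoly GhostPoly x + ∑ k, ((κ * l₂ k) • frameTheta t ψ 3 (pairs k).1 (pairs k).2
    + (-(κ * l₁ k)) • frameTheta t ψ 4 (pairs k).1 (pairs k).2
    + (κ * m₁ k) • frameTheta t ψ 1 (pairs k).1 (pairs k).2
    + (-(κ * m₂ k)) • frameTheta t ψ 0 (pairs k).1 (pairs k).2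
    + (κ * m₃ k) • frameTheta t ψ 2 (pairs k).1 (pairs k).2
    + (C (1 / 2) * κ * n k) • theta γ Ch (pairs k).1 (pairs k).2), ?_, ?_⟩
  · refine add_mem (algebraMap_mem_repSubmodule _ _ _) (sum_mem fun k _ => ?_)
    exact add_mem (add_mem (add_mem (add_mem (add_mem (Submodule.smul_mem _ _ (hT _ _))
      (Submodule.smul_mem _ _ (hT _ _))) (Submodule.smul_mem _ _ (hT _ _)))
      (Submodule.smul_mem _ _ (hT _ _))) (Submodule.smul_mem _ _ (hT _ _)))
      (Submodule.smul_mem _ _ (theta_mem_repSubmodule _ _ _))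
  · have h := (hasPart_algebraMap (t := t) x).add (HasPart.sum fun k =>
      ((((((hasPart_frameTheta ψ 3 (pairs k).1 (pairs k).2).smul (κ * l₂ k)).add
      ((hasPart_frameTheta ψ 4 (pairs k).1 (pairs k).2).smul (-(κ * l₁ k)))).add
      ((hasPart_frameTheta ψ 1 (pairs k).1 (pairs k).2).smul (κ * m₁ k))).add
      ((hasPart_frameTheta ψ 0 (pairs k).1 (pairs k).2).smul (-(κ * m₂ k)))).add
      ((hasPart_frameTheta ψ 2 (pairs k).1 (pairs k).2).smul (κ * m₃ k))).add
      ((hθ (pairs k).1 (pairs k).2).smul (C (1 / 2) * κ * n k)))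
    convert h using 2
    simp only [Fin.sum_univ_three, pairs, Matrix.cons_val]
    simp only [cocycle3, symSum, Prod.ext_iff, Prod.fst_add, Prod.snd_add, Prod.smul_fst,
      Prod.smul_snd, smul_eq_mul, Prod.fst_zero, Prod.snd_zero, frameBil_self, frameBil_swap 0 1,
      frameBil_swap 0 2, frameBil_swap 1 2, frameBil_zero_one, frameBil_zero_two, frameBil_one_two,
      frameBil_zero_three, frameBil_one_three, frameBil_two_three, frameBil_zero_four,
      frameBil_one_four, frameBil_two_four, map_neg, map_mul, map_add, map_zero]
    refine ⟨⟨⟨?_, ?_⟩, ?_, ?_⟩, ⟨?_, ?_⟩, ?_, ?_⟩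
    all_goals
      simp only [neg_mul, mul_neg, neg_neg, hG, hG']
      ring

/-- Transport to the double cone through `model5`. Regularity of the last two quadrics holds
componentwise because `Kosz3` is free and `ψ` is an automorphism. -/
theorem exists_rep (hS : IsUnit S) (hγ : ∀ a, γ a = S⁻¹ * stdGamma t a * S)
    (hC : Ch = Sᵀ * stdC * S) (ω : GhostPoly) (hω : fb t γ Ch ω = 0) :
    ∃ ρ ∈ repSubmodule γ Ch, ∃ η, ω = fb t γ Ch η + ρ := by
  set ψ := spinorEquiv S hS with hψ
  have hM := isKoszulModel_model5 hS hγ hC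
  rw [← hψ] at hM
  have hne : ψ (quad 4) ≠ 0 := by
    rw [Ne, map_eq_zero_iff _ ψ.injective]
    exact minor_ne_zero 1
  have hreg : ∀ m n : XiPoly, ψ (quad 3) * m = ψ (quad 4) * n → ∃ r, m = ψ (quad 4) * r := by
    intro m n h
    have h' := congrArg ψ.symm h
    simp only [map_mul, AlgEquiv.symm_apply_apply] at h'
    obtain ⟨r, hr⟩ := minor_regular h'
    refine ⟨ψ r, ?_⟩
    have := congrArg ψ hr
    rw [map_mul, AlgEquiv.apply_symm_apply] at this
    exact this
  obtain ⟨m, rfl⟩ := hM.surjective (span_frameVec t) ω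
  rw [fb_eq_contract, hM.comm] at hω
  obtain ⟨θ, hθ, η, rfl⟩ := cone_cone_exact (kosz3 ψ) (kosz3_kosz3 ψ) (ψ (quad 3)) (ψ (quad 4))
    (fun m hm => by
      simpa only [Prod.ext_iff, Prod.smul_fst, Prod.smul_snd, Prod.fst_zero, Prod.snd_zero,
        smul_eq_mul, mul_eq_zero, hne, false_or] using hm)
    (fun m n hmn => by
      obtain ⟨⟨⟨x, x₀⟩, x₁, x₀₁⟩, ⟨x₂, x₀₂⟩, x₁₂, x₀₁₂⟩ := m
      simp only [Prod.ext_iff, Prod.smul_fst, Prod.smul_snd, smul_eq_mul] at hmn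
      obtain ⟨⟨⟨h0, h1⟩, h2, h3⟩, ⟨h4, h5⟩, h6, h7⟩ := hmn
      obtain ⟨y0, rfl⟩ := hreg _ _ h0
      obtain ⟨y1, rfl⟩ := hreg _ _ h1
      obtain ⟨y2, rfl⟩ := hreg _ _ h2
      obtain ⟨y3, rfl⟩ := hreg _ _ h3
      obtain ⟨y4, rfl⟩ := hreg _ _ h4
      obtain ⟨y5, rfl⟩ := hreg _ _ h5
      obtain ⟨y6, rfl⟩ := hreg _ _ h6
      obtain ⟨y7, rfl⟩ := hreg _ _ h7
      exact ⟨(((y0, y1), (y2, y3)), ((y4, y5), (y6, y7))), rfl⟩)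
    -- Taking all preimages of representatives makes the cocycle condition automatic, and only the
    -- part free of `e₃, e₄` has to be matched.
    {m | model5 t m ∈ repSubmodule γ Ch}
    (fun θ hθ => hM.inj _ (by
      rw [← hM.comm, ← fb_eq_contract]
      exact fb_eq_zero_of_mem_repSubmodule hS hγ hC hθ))
    (fun α β γ' h => by
      obtain ⟨x, l₁, l₂, m₁, m₂, m₃, n, η, ζ, ξ, hα⟩ := kosz3_exact ψ α β γ' h
      obtain ⟨_, hρ, m, rfl, hm⟩ := exists_hasPart hS hγ hC x l₁ l₂ m₁ m₂ m₃ n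
      exact ⟨m, hρ, η, ζ, ξ, by rw [hα, hm]⟩)
    m (hM.inj _ hω)
  exact ⟨model5 t θ, hθ, model5 t η, by rw [fb_eq_contract, hM.comm, map_add]⟩

end Rep

end Susy5

end

/-! ### The cohomology theorem. -/

theorem mainTheorem4 (t : ℕ) (ht : t ≤ 5)
    (γ : Fin 5 → Susy5.SpinorMatrix) (C : Susy5.SpinorMatrix)
    (hrep : Susy5.IsSpinorRep t γ C) :
    (∀ ω : Susy5.GhostPoly,
      Susy5.fb t γ C ω = 0 ↔
        ∃ (P P11 P12 P22 : Susy5.XiPoly) (Q11 Q12 Q22 : Fin 5 → Susy5.XiPoly),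
          Susy5.Equivalent t γ C ω (Susy5.representative γ C P P11 P12 P22 Q11 Q12 Q22)) ∧
    (∀ p : ℕ, 2 < p → ∀ ω : Susy5.GhostPoly,
      ω ∈ ⋀[Susy5.XiPoly]^p (Fin 5 → Susy5.XiPoly) →
        (Susy5.fb t γ C ω = 0 ↔ Susy5.Equivalent t γ C ω 0)) := by
  obtain ⟨S, hS, hγ, hC⟩ := hrep
  refine ⟨fun ω => ⟨fun h => ?_, ?_⟩, fun p hp ω hω => ⟨fun h => ?_, ?_⟩⟩
  · obtain ⟨_, ⟨P, P11, P12, P22, Q11, Q12, Q22, rfl⟩, η, h⟩ := Susy5.exists_rep hS hγ hC ω h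
    exact ⟨P, P11, P12, P22, Q11, Q12, Q22, η, by rw [h, add_sub_cancel_right]⟩
  · rintro ⟨P, P11, P12, P22, Q11, Q12, Q22, η, h⟩
    rw [sub_eq_iff_eq_add.1 h, map_add, Susy5.fb_fb, zero_add]
    exact Susy5.fb_eq_zero_of_mem_repSubmodule hS hγ hC ⟨P, P11, P12, P22, Q11, Q12, Q22, rfl⟩
  · obtain ⟨ρ, hρ, η, h⟩ := Susy5.exists_rep hS hγ hC ω h
    rw [Susy5.fb_eq_contract] at h
    -- The representative has no component of degree `p > 2`, so projecting to degree `p` leaves a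
    -- pure coboundary.
    obtain ⟨y, hy⟩ := Susy5.exists_eq_contract_of_mem _ p hω
      (Susy5.proj_eq_zero_of_mem_repSubmodule hp hρ) h
    exact ⟨y, by rw [Susy5.fb_eq_contract, sub_zero, hy]⟩
  · rintro ⟨η, h⟩
    rw [sub_zero] at h
    rw [h, Susy5.fb_fb]
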